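/- Let $N\in\mathbb N$, $0<s<1$, $N>2s$, $2^*_s=\frac{2N}{N-2s}$, $2<\theta<p<2^*_s\le q$, $R>1$ and $\Lambda>0$. Assume the following. (f) $f\in C(\mathbb R,\mathbb R)$, $f\not\equiv0$, $f\ge0$ on $(0,\infty)$, $f=0$ on $(-\infty,0]$, $\limsup_{t\to0^+}f(t)/t^{2^*_s-1}<\infty$, $\limsup_{t\to\infty}f(t)/t^{p-1}<\infty$, and $\theta F(t)\le tf(t)$ for all $t\in\mathbb R$, where $F(t)=\int_0^tf$. (V) $V\in L^\infty_{\rm loc}(\mathbb R^N)$, $V\ge0$ a.e., and $R^{-4s}V(x)|x|^{4s}\ge\Lambda$ for a.e. $|x|\ge R$. (K) $K_s:\mathbb R^N\to\mathbb R$ is measurable, positive on $\mathbb R^N\setminus\{0\}$ and even; $\min\{|x|^2,1\}K_s\in L^1(\mathbb R^N)$; and there are $\mathcal C_1,\mathcal C_2>0$ with $$\mathcal C_1|x|^{-(N+2s)}\le K_s(x)\le\mathcal C_2|x|^{-(N+2s)}\quad\text{for a.e. }x.$$ Write $[u,v]=\iint(u(x)-u(y))(v(x)-v(y))K_s(x-y)\,dx\,dy$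 and $\Gamma_*(x)=\min\{|x|^{-(N-2s)},R^{-(N-2s)}\}$. Assume also that $[\Gamma_*,\phi]\ge0$ for all $0\le\phi\in C_0^\infty(\mathbb R^N\setminus\overline B_R)$. Let $E$ be the space of all $u\in L^{2^*_s}(\mathbb R^N)$ with $[u,u]<\infty$ and $\int Vu^2<\infty$, with inner product $(u,v)=[u,v]+\int Vuv$ and norm $\|u\|=\sqrt{(u,u)}$. For $\lambda>0$ and $k\in\mathbb N$ let $$f_{\lambda,k}(t)=\begin{cases}0,&t<0,\\ f(t)+\lambda t^{q-1},&0\le t\le k,\\ f(t)+\lambda k^{q-p}t^{p-1},&t\ge k,\end{cases}$$ and let $\nu=\frac{2\theta}{\theta-2}$. Put $g_{\lambda,k}(x,t)=0$ for $t<0$. For $t\ge0$, put $g_{\lambda,k}(x,t)=f_{\lambda,k}(t)$ if $|x|\le R$ or $\nu f_{\lambda,k}(t)\le V(x)t$, and $g_{\lambda,k}(x,t)=\frac1\nu V(x)t$ otherwise. Let $G_{\lambda,k}(x,t)=\int_0^tg_{\lambda,k}(x,\tau)\,d\tau$, let $J_{\lambda,k}(u)=\frac12\|u\|^2-\int G_{\lambda,k}(x,u)\,dx$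 on $E$, and let $$c(J_{\lambda,k})=\inf_\gamma\max_{t\in[0,1]}J_{\lambda,k}(\gamma(t)),$$ the infimum being taken over all $\gamma\in C([0,1],E)$ with $\gamma(0)=0$ and $J_{\lambda,k}(\gamma(1))<0$. Then there is a constant $C_*>0$, independent of $\lambda$ and $k$, such that for all $\lambda>0$ and $k\in\mathbb N$ the following holds. Let $u_{\lambda,k}\in E$ be any mountain-pass solution of the auxiliary problem $\mathcal L_{K_s}u+V(x)u=g_{\lambda,k}(x,u)$, i.e. $(u_{\lambda,k},v)=\int g_{\lambda,k}(x,u_{\lambda,k})v\,dx$ for all $v\in E$ and $J_{\lambda,k}(u_{\lambda,k})=c(J_{\lambda,k})$. Then $$\|u_{\lambda,k}\|_\infty\le C_*(1+\lambda k^{q-p})^{\frac1{2^*_s-p}}$$ and, with the same constant $C_*$, $$u_{\lambda,k}(x)\le C_*R^{N-2s}(1+\lambda k^{q-p})^{\frac1{2^*_s-p}}|x|^{-(N-2s)}\quad\text{for a.e. }|x|>R.$$ -/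

import Mathlib

open MeasureTheory Filter Topology
open scoped ContDiff

namespace NonlocalSchrodinger

/-- The space `ℝ^N` with its Euclidean norm and Lebesgue measure. -/
abbrev Space (N : ℕ) : Type := EuclideanSpace ℝ (Fin N)

noncomputable section

/-- The fractional critical Sobolev exponent `2N / (N - 2s)`. -/
def critExp (N : ℕ) (s : ℝ) : ℝ := 2 * (N : ℝ) / ((N : ℝ) - 2 * s)

/-- The primitive `F(t) = ∫₀ᵗ f(τ) dτ`. -/
def primitive (f : ℝ → ℝ) (t : ℝ) : ℝ := ∫ τ in (0 : ℝ)..t, f τ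

/-- The standing assumptions on the nonlinearity `f`. A statement `limsup < +∞` is expressed by the
quotient being eventually bounded above. -/
structure NonlinearityAssumptions (N : ℕ) (s p θ : ℝ) (f : ℝ → ℝ) : Prop where
  continuous : Continuous f
  ne_zero : f ≠ 0
  nonneg : ∀ t, 0 < t → 0 ≤ f t
  eq_zero : ∀ t, t ≤ 0 → f t = 0
  two_lt_p : 2 < p
  p_lt : p < critExp N s
  limsup_zero : IsBoundedUnder (· ≤ ·) (𝓝[>] (0 : ℝ)) (fun t => f t / t ^ (critExp N s - 1))
  limsup_top : IsBoundedUnder (· ≤ ·) atTop (fun t => f t / t ^ (p - 1))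
  two_lt_θ : 2 < θ
  θ_lt : θ < p
  ambrosetti_rabinowitz : ∀ t, θ * primitive f t ≤ t * f t

/-- The standing assumptions on the potential `V`: it is locally essentially bounded, nonnegative,
and `R^(-4s) inf_{|x| ≥ R} V(x)|x|^(4s) ≥ Λ` (with the infimum taken up to null sets). -/
structure PotentialAssumptions (N : ℕ) (s R Λ : ℝ) (V : Space N → ℝ) : Prop where
  locally_bounded : ∀ A : Set (Space N), IsCompact A → MemLp V ⊤ (volume.restrict A)
  nonneg : ∀ᵐ x : Space N, 0 ≤ V x
  one_lt_R : 1 < R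
  Λ_pos : 0 < Λ
  lower_bound : ∀ᵐ x : Space N, R ≤ ‖x‖ → Λ ≤ 1 / R ^ (4 * s) * (V x * ‖x‖ ^ (4 * s))

/-- The form `[u,v] = ∬ (u(x) - u(y)) (v(x) - v(y)) K(x - y) dx dy`. -/
def form {N : ℕ} (K : Space N → ℝ) (u v : Space N → ℝ) : ℝ :=
  ∫ z : Space N × Space N, (u z.1 - u z.2) * (v z.1 - v z.2) * K (z.1 - z.2)

/-- The truncated fundamental solution `Γ_*(x) = min {|x|^(-(N-2s)), R^(-(N-2s))}`, written as
`(max |x| R)^(-(N-2s))`, which also gives the intended value `R^(-(N-2s))` at the origin. -/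
def gammaStar (N : ℕ) (s R : ℝ) (x : Space N) : ℝ := (max ‖x‖ R) ^ (-((N : ℝ) - 2 * s))

theorem gammaStar_eq_min {N : ℕ} {s R : ℝ} (hN : 2 * s < N) (hR : 0 < R) {x : Space N}
    (hx : x ≠ 0) :
    gammaStar N s R x = min (‖x‖ ^ (-((N : ℝ) - 2 * s))) (R ^ (-((N : ℝ) - 2 * s))) := by
  have hx0 : 0 < ‖x‖ := norm_pos_iff.mpr hx
  have he : -((N : ℝ) - 2 * s) ≤ 0 := by linarith
  unfold gammaStar
  rcases le_total ‖x‖ R with h | h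
  · rw [max_eq_right h, min_eq_right (Real.rpow_le_rpow_of_nonpos hx0 h he)]
  · rw [max_eq_left h, min_eq_left (Real.rpow_le_rpow_of_nonpos hR h he)]

/-- The assumptions on the kernel `K`. The last field says that `Γ_*` is a weak supersolution of
`L_K` in the complement of the closed ball of radius `R`. Kernels need not be defined at the origin,
so positivity is asked only away from it. -/
structure KernelAssumptions (N : ℕ) (s R : ℝ) (K : Space N → ℝ) : Prop where
  measurable : Measurable K
  pos : ∀ x, x ≠ 0 → 0 < K x
  even : ∀ x, K (-x) = K x
  lower : ∃ c : ℝ, 0 < c ∧ ∀ᵐ x : Space N, c * ‖x‖ ^ (-((N : ℝ) + 2 * s)) ≤ K x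
  integrable : Integrable (fun x : Space N => min (‖x‖ ^ 2) 1 * K x)
  upper : ∃ c : ℝ, 0 < c ∧ ∀ᵐ x : Space N, K x ≤ c * ‖x‖ ^ (-((N : ℝ) + 2 * s))
  supersolution : ∀ φ : Space N → ℝ, ContDiff ℝ ∞ φ → HasCompactSupport φ →
    tsupport φ ⊆ (Metric.closedBall 0 R)ᶜ → (∀ x, 0 ≤ φ x) →
    0 ≤ form K (gammaStar N s R) φ

/-- Membership in the energy space `E` (of representatives of classes of a.e. equal functions). -/
structure MemE {N : ℕ} (s : ℝ) (K V : Space N → ℝ) (u : Space N → ℝ) : Prop where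
  memLp : MemLp u (ENNReal.ofReal (critExp N s)) volume
  finite_form : Integrable
    (fun z : Space N × Space N => (u z.1 - u z.2) ^ 2 * K (z.1 - z.2))
  finite_potential : Integrable (fun x : Space N => V x * u x ^ 2)

/-- The inner product `(u,v) = [u,v] + ∫ V u v` of `E`. -/
def innerE {N : ℕ} (K V : Space N → ℝ) (u v : Space N → ℝ) : ℝ :=
  form K u v + ∫ x : Space N, V x * u x * v x

/-- The norm of `E`. -/
def normE {N : ℕ} (K V : Space N → ℝ) (u : Space N → ℝ) : ℝ := Real.sqrt (innerE K V u u)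

/-- The truncated nonlinearity `f_{λ,k}`. -/
def fTrunc (f : ℝ → ℝ) (p q lam : ℝ) (k : ℕ) (t : ℝ) : ℝ :=
  if t < 0 then 0
  else if t ≤ k then f t + lam * t ^ (q - 1)
  else f t + lam * (k : ℝ) ^ (q - p) * t ^ (p - 1)

/-- The penalized nonlinearity used outside the ball of radius `R`, with `ν = 2θ / (θ - 2)`. -/
def fBar {N : ℕ} (f : ℝ → ℝ) (V : Space N → ℝ) (p q θ lam : ℝ) (k : ℕ) (x : Space N) (t : ℝ) : ℝ :=
  if t < 0 then 0
  else if 2 * θ / (θ - 2) * fTrunc f p q lam k t ≤ V x * t then fTrunc f p q lam k t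
  else 1 / (2 * θ / (θ - 2)) * V x * t

/-- The nonlinearity `g_{λ,k}` of the auxiliary problem. -/
def gAux {N : ℕ} (f : ℝ → ℝ) (V : Space N → ℝ) (p q θ R lam : ℝ) (k : ℕ) (x : Space N)
    (t : ℝ) : ℝ :=
  if ‖x‖ ≤ R then fTrunc f p q lam k t else fBar f V p q θ lam k x t

/-- The energy functional `J_{λ,k}(u) = ½ ‖u‖² - ∫ G_{λ,k}(x,u) dx`, where
`G_{λ,k}(x,t) = ∫₀ᵗ g_{λ,k}(x,τ) dτ`. -/
def energy {N : ℕ} (f : ℝ → ℝ) (K V : Space N → ℝ) (p q θ R lam : ℝ) (k : ℕ)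
    (u : Space N → ℝ) : ℝ :=
  1 / 2 * normE K V u ^ 2 - ∫ x : Space N, primitive (gAux f V p q θ R lam k x) (u x)

/-- Admissible paths for a functional `J` on `E`: `γ : [0,1] → E` is continuous in the norm of `E`,
`γ(0) = 0` and `J(γ(1)) < 0`. -/
structure IsAdmissiblePath {N : ℕ} (s : ℝ) (K V : Space N → ℝ) (J : (Space N → ℝ) → ℝ)
    (γ : unitInterval → Space N → ℝ) : Prop where
  mem : ∀ t, MemE s K V (γ t)
  continuous : ∀ t, Tendsto (fun r => normE K V (γ r - γ t)) (𝓝 t) (𝓝 0)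
  start : γ 0 =ᵐ[volume] 0
  finish : J (γ 1) < 0

/-- The minimax level `c(J) = inf_γ max_{t ∈ [0,1]} J(γ(t))` over the admissible paths. -/
def minimaxLevel {N : ℕ} (s : ℝ) (K V : Space N → ℝ) (J : (Space N → ℝ) → ℝ) : ℝ :=
  sInf {m : ℝ | ∃ γ : unitInterval → Space N → ℝ,
    IsAdmissiblePath s K V J γ ∧ IsGreatest (Set.range fun t => J (γ t)) m}

/-- `u ∈ E` is a weak solution of `L_K u + V u = g_{λ,k}(x,u)` in `ℝ^N`. -/
structure IsAuxSolution {N : ℕ} (s : ℝ) (f : ℝ → ℝ) (K V : Space N → ℝ) (p q θ R lam : ℝ) (k : ℕ)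
    (u : Space N → ℝ) : Prop where
  mem : MemE s K V u
  weak : ∀ v : Space N → ℝ, MemE s K V v →
    innerE K V u v = ∫ x : Space N, gAux f V p q θ R lam k x (u x) * v x

end

end NonlocalSchrodinger

open NonlocalSchrodinger

/-!
The bound and the decay come from three facts, each uniform in `λ` and `k`.

*Energy.* On multiples of a tent supported in the ball of radius `R`, where the nonlinearity is not
penalized, the energy is at most the one with `f` alone, since `f ≤ f_{λ,k}`. This bounds the
minimax level (`exists_minimaxLevel_le`), and the Ambrosetti–Rabinowitz condition, which survives
the truncation, turns the bound of the level into a bound of the solution in `E`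
(`IsAuxSolution.innerE_le`). The choice `ν = 2θ/(θ-2)` lets the penalized part be absorbed.

*Boundedness.* Solutions are nonnegative and satisfy `L_K u ≤ A u^(p-1)` with `A` a constant times
`1 + λ k^(q-p)`. Testing with `(u - h)⁺` and the Sobolev inequality (`sobolev`) give the estimate
that a De Giorgi iteration over the levels `M (2 - 2^(-i))` needs
(`ae_le_of_truncation_estimate`). The iteration starts if `M^(2^*_s-p)` exceeds a constant times `A`,
whence the exponent `1/(2^*_s-p)` (`exists_forall_ae_le`). The Sobolev inequality itself is the
integral of a pointwise bound of `|u(x)|^(2^*_s)` by the energy density at `x`.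

*Decay.* For `|x| > R` the penalization gives `L_K u ≤ 0`, while the multiple of `Γ_*` equal to the
bound `M` of `u` on the ball is a supersolution there. Comparison is made with the test function
`(u - M R^(N-2s) Γ_* - δ)⁺`: subtracting `δ` makes it vanish near the closed ball and gives it a
support of finite measure (`IsAuxSolution.ae_le_gammaStar`). That `Γ_*` is a supersolution also
against such non-smooth functions (`KernelAssumptions.form_gammaStar_nonneg`) follows by
mollification, which averages the form over translates of `Γ_*`, and by cutting off; only the
boundedness and Lipschitz continuity of `Γ_*` are used in these limits.
-/

namespace NonlocalSchrodinger

/-! ### The quadratic form -/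

section Form

variable {N : ℕ} {s R : ℝ} {K : Space N → ℝ}

theorem KernelAssumptions.ae_nonneg (hK : KernelAssumptions N s R K) : ∀ᵐ x, 0 ≤ K x := by
  obtain ⟨c, hc, h⟩ := hK.lower
  filter_upwards [h] with x hx
  exact le_trans (by positivity) hx

theorem quasiMeasurePreserving_diff :
    Measure.QuasiMeasurePreserving (fun z : Space N × Space N => z.1 - z.2) :=
  quasiMeasurePreserving_sub_of_right_invariant volume volume

theorem KernelAssumptions.ae_nonneg_prod (hK : KernelAssumptions N s R K) :
    ∀ᵐ z : Space N × Space N, 0 ≤ K (z.1 - z.2) :=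
  quasiMeasurePreserving_diff.ae hK.ae_nonneg

theorem KernelAssumptions.measurable_diff (hK : KernelAssumptions N s R K) :
    Measurable fun z : Space N × Space N => K (z.1 - z.2) :=
  hK.measurable.comp (measurable_fst.sub measurable_snd)

theorem aestronglyMeasurable_fst {u : Space N → ℝ} (hu : AEStronglyMeasurable u) :
    AEStronglyMeasurable (fun z : Space N × Space N => u z.1) :=
  hu.comp_quasiMeasurePreserving Measure.quasiMeasurePreserving_fst

theorem aestronglyMeasurable_snd {u : Space N → ℝ} (hu : AEStronglyMeasurable u) :
    AEStronglyMeasurable (fun z : Space N × Space N => u z.2) :=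
  hu.comp_quasiMeasurePreserving Measure.quasiMeasurePreserving_snd

theorem aestronglyMeasurable_diff {u : Space N → ℝ} (hu : AEStronglyMeasurable u) :
    AEStronglyMeasurable (fun z : Space N × Space N => u z.1 - u z.2) :=
  (aestronglyMeasurable_fst hu).sub (aestronglyMeasurable_snd hu)

/-- Finiteness of the energy `[u,u]`, in the form in which it enters `MemE`. -/
def FiniteEnergy (K : Space N → ℝ) (u : Space N → ℝ) : Prop :=
  Integrable (fun z : Space N × Space N => (u z.1 - u z.2) ^ 2 * K (z.1 - z.2))

theorem form_self (u : Space N → ℝ) :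
    form K u u = ∫ z : Space N × Space N, (u z.1 - u z.2) ^ 2 * K (z.1 - z.2) := by
  simp only [form, sq]

theorem FiniteEnergy.of_sq_le (hK : KernelAssumptions N s R K) {v : Space N → ℝ}
    (hv : AEStronglyMeasurable v) {H : Space N × Space N → ℝ}
    (hH : Integrable fun z : Space N × Space N => H z * K (z.1 - z.2))
    (h : ∀ᵐ z : Space N × Space N, (v z.1 - v z.2) ^ 2 ≤ H z) : FiniteEnergy K v := by
  refine hH.mono' (((aestronglyMeasurable_diff hv).pow 2).mul
    hK.measurable_diff.aestronglyMeasurable) ?_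
  filter_upwards [h, hK.ae_nonneg_prod] with z hz hKz
  rw [Real.norm_of_nonneg (by positivity)]
  exact mul_le_mul_of_nonneg_right hz hKz

theorem integrable_form_of_integrable_sq (hK : KernelAssumptions N s R K) {u v : Space N → ℝ}
    (hu : AEStronglyMeasurable u) (hv : AEStronglyMeasurable v)
    {H₁ H₂ : Space N × Space N → ℝ}
    (hH₁ : Integrable fun z : Space N × Space N => H₁ z * K (z.1 - z.2))
    (hH₂ : Integrable fun z : Space N × Space N => H₂ z * K (z.1 - z.2))
    (h : ∀ᵐ z : Space N × Space N, |(u z.1 - u z.2) * (v z.1 - v z.2)| ≤ H₁ z + H₂ z) :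
    Integrable fun z : Space N × Space N =>
      (u z.1 - u z.2) * (v z.1 - v z.2) * K (z.1 - z.2) := by
  refine (hH₁.add hH₂).mono' (((aestronglyMeasurable_diff hu).mul
    (aestronglyMeasurable_diff hv)).mul hK.measurable_diff.aestronglyMeasurable) ?_
  filter_upwards [h, hK.ae_nonneg_prod] with z hz hKz
  rw [Real.norm_eq_abs, abs_mul, abs_of_nonneg hKz]
  calc _ ≤ (H₁ z + H₂ z) * K (z.1 - z.2) := mul_le_mul_of_nonneg_right hz hKz
    _ = _ := by simp only [Pi.add_apply]; ring

theorem abs_mul_le_sq_add_sq (a b : ℝ) : |a * b| ≤ a ^ 2 + b ^ 2 := by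
  rw [abs_le]
  constructor <;> nlinarith [sq_nonneg (a + b), sq_nonneg (a - b)]

theorem FiniteEnergy.integrable_form (hK : KernelAssumptions N s R K) {u v : Space N → ℝ}
    (hu : AEStronglyMeasurable u) (hv : AEStronglyMeasurable v)
    (hu' : FiniteEnergy K u) (hv' : FiniteEnergy K v) :
    Integrable fun z : Space N × Space N =>
      (u z.1 - u z.2) * (v z.1 - v z.2) * K (z.1 - z.2) :=
  integrable_form_of_integrable_sq hK hu hv (H₁ := fun z => (u z.1 - u z.2) ^ 2)
    (H₂ := fun z => (v z.1 - v z.2) ^ 2) hu' hv'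
    (Eventually.of_forall fun _ => abs_mul_le_sq_add_sq _ _)

theorem form_self_nonneg (hK : KernelAssumptions N s R K) (u : Space N → ℝ) :
    0 ≤ form K u u := by
  rw [form_self]
  refine integral_nonneg_of_ae ?_
  filter_upwards [hK.ae_nonneg_prod] with z hz
  exact mul_nonneg (sq_nonneg _) hz

theorem form_congr {u u' v v' : Space N → ℝ} (hu : u =ᵐ[volume] u') (hv : v =ᵐ[volume] v') :
    form K u v = form K u' v' := by
  unfold form
  refine integral_congr_ae ?_
  have q₁ : Measure.QuasiMeasurePreserving (Prod.fst : Space N × Space N → Space N) :=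
    Measure.quasiMeasurePreserving_fst
  have q₂ : Measure.QuasiMeasurePreserving (Prod.snd : Space N × Space N → Space N) :=
    Measure.quasiMeasurePreserving_snd
  filter_upwards [q₁.ae hu, q₂.ae hu, q₁.ae hv, q₂.ae hv] with z h1 h2 h3 h4
  rw [h1, h2, h3, h4]

/-- `[v,v] ≤ [u,v]` whenever this holds for the increments, as for `v` a truncation of `u`. -/
theorem form_self_le_form (hK : KernelAssumptions N s R K) {u v : Space N → ℝ}
    (hv' : FiniteEnergy K v)
    (huv : Integrable fun z : Space N × Space N =>
      (u z.1 - u z.2) * (v z.1 - v z.2) * K (z.1 - z.2))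
    (h : ∀ᵐ z : Space N × Space N,
      (v z.1 - v z.2) ^ 2 ≤ (u z.1 - u z.2) * (v z.1 - v z.2)) :
    form K v v ≤ form K u v := by
  rw [form_self]
  refine integral_mono_ae hv' huv ?_
  filter_upwards [h, hK.ae_nonneg_prod] with z hz hKz
  exact mul_le_mul_of_nonneg_right hz hKz

/-- The function `w` is Lipschitz and of bounded oscillation, expressed by one bound for the squared
increments that is integrable against the kernel in the variable `x - y`. -/
def HasBoundedIncrements (C : ℝ) (w : Space N → ℝ) : Prop :=
  ∀ x y, (w x - w y) ^ 2 ≤ C * min (‖x - y‖ ^ 2) 1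

theorem HasBoundedIncrements.of_lipschitz {w : Space N → ℝ} {L : ℝ}
    (hL : ∀ x y, |w x - w y| ≤ L * ‖x - y‖) {B : ℝ} (hB : ∀ x y, |w x - w y| ≤ B) :
    HasBoundedIncrements (L ^ 2 + B ^ 2) w := by
  intro x y
  have h1 := hL x y
  have h2 := hB x y
  have e1 : (w x - w y) ^ 2 ≤ (L * ‖x - y‖) ^ 2 := by
    rw [← sq_abs]; gcongr
  have e2 : (w x - w y) ^ 2 ≤ B ^ 2 := by
    rw [← sq_abs]; gcongr
  rcases min_choice (‖x - y‖ ^ 2) 1 with h | h <;> rw [h]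
  · nlinarith [sq_nonneg (B * ‖x - y‖)]
  · nlinarith [sq_nonneg L]

theorem integrable_indicator_snd_kernel (hK : KernelAssumptions N s R K) {S : Set (Space N)}
    (hS : MeasurableSet S) (hS' : volume S ≠ ⊤) :
    Integrable fun z : Space N × Space N =>
      (S.indicator 1 z.2 * min (‖z.1 - z.2‖ ^ 2) 1) * K (z.1 - z.2) := by
  have h1 : Integrable (S.indicator (1 : Space N → ℝ)) :=
    (integrable_indicator_iff hS).2 (integrableOn_const (C := (1 : ℝ)) hS')
  have h2 := hK.integrable.mul_prod h1
  have h3 := (measurePreserving_sub_prod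
    (volume : Measure (Space N)) volume).integrable_comp_of_integrable h2
  refine h3.congr (Eventually.of_forall fun z => ?_)
  simp only [Function.comp_apply]
  ring

theorem integrable_indicator_fst_kernel (hK : KernelAssumptions N s R K) {S : Set (Space N)}
    (hS : MeasurableSet S) (hS' : volume S ≠ ⊤) :
    Integrable fun z : Space N × Space N =>
      (S.indicator 1 z.1 * min (‖z.1 - z.2‖ ^ 2) 1) * K (z.1 - z.2) := by
  have h1 : Integrable (fun z : Space N × Space N =>
      (S.indicator 1 z.1 * min (‖z.2 - z.1‖ ^ 2) 1) * K (z.2 - z.1)) :=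
    (integrable_indicator_snd_kernel hK hS hS').swap
  refine h1.congr (Eventually.of_forall fun z => ?_)
  have : K (z.2 - z.1) = K (z.1 - z.2) := by rw [← hK.even, neg_sub]
  simp only [this, norm_sub_rev z.2 z.1]

/-- The weight `(1_S(x) + 1_S(y)) min(|x-y|², 1)`; against the kernel it is integrable as soon as
`S` has finite measure. -/
noncomputable def localWeight (S : Set (Space N)) (z : Space N × Space N) : ℝ :=
  (S.indicator 1 z.1 + S.indicator 1 z.2) * min (‖z.1 - z.2‖ ^ 2) 1

theorem integrable_localWeight (hK : KernelAssumptions N s R K) {S : Set (Space N)}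
    (hS : MeasurableSet S) (hS' : volume S ≠ ⊤) :
    Integrable fun z : Space N × Space N => localWeight S z * K (z.1 - z.2) := by
  refine ((integrable_indicator_fst_kernel hK hS hS').add
    (integrable_indicator_snd_kernel hK hS hS')).congr (Eventually.of_forall fun z => ?_)
  simp only [localWeight, Pi.add_apply]
  ring

theorem min_le_localWeight {S : Set (Space N)} {z : Space N × Space N} (h : z.1 ∈ S ∨ z.2 ∈ S) :
    min (‖z.1 - z.2‖ ^ 2) 1 ≤ localWeight S z := by
  have h0 : (0 : ℝ) ≤ min (‖z.1 - z.2‖ ^ 2) 1 := by positivity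
  unfold localWeight
  refine le_mul_of_one_le_left h0 ?_
  have i0 : ∀ x, (0 : ℝ) ≤ S.indicator 1 x := fun x => Set.indicator_nonneg (by simp) x
  rcases h with h | h
  · have := i0 z.2
    rw [Set.indicator_of_mem h]; simpa using this
  · have := i0 z.1
    rw [Set.indicator_of_mem h]; simpa using this

theorem localWeight_nonneg (S : Set (Space N)) (z : Space N × Space N) : 0 ≤ localWeight S z := by
  have i0 : ∀ x, (0 : ℝ) ≤ S.indicator 1 x := fun x => Set.indicator_nonneg (by simp) x
  unfold localWeight
  have := i0 z.1
  have := i0 z.2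
  positivity

/-- The product of increments vanishes unless one of the two points lies in `S`; this is why
`w` itself needs neither decay nor finite energy. -/
theorem abs_mul_le_localWeight {C : ℝ} {w v : Space N → ℝ} (hw : HasBoundedIncrements C w)
    (hC : 0 ≤ C) {S : Set (Space N)} {z : Space N × Space N} (h1 : z.1 ∉ S → v z.1 = 0)
    (h2 : z.2 ∉ S → v z.2 = 0) :
    |(w z.1 - w z.2) * (v z.1 - v z.2)| ≤ C * localWeight S z + (v z.1 - v z.2) ^ 2 := by
  by_cases h : z.1 ∈ S ∨ z.2 ∈ S
  · calc _ ≤ (w z.1 - w z.2) ^ 2 + (v z.1 - v z.2) ^ 2 := abs_mul_le_sq_add_sq _ _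
      _ ≤ C * localWeight S z + _ := by
        gcongr
        exact (hw _ _).trans (by gcongr; exact min_le_localWeight h)
  · push Not at h
    rw [h1 h.1, h2 h.2]
    have := localWeight_nonneg S z
    simp; positivity

/-- A function with bounded increments and finite-measure support has finite energy. -/
theorem HasBoundedIncrements.finiteEnergy (hK : KernelAssumptions N s R K) {C : ℝ}
    {w : Space N → ℝ} (hw : HasBoundedIncrements C w) (hC : 0 ≤ C)
    (hm : AEStronglyMeasurable w) {S : Set (Space N)}
    (hS : MeasurableSet S) (hS' : volume S ≠ ⊤) (h : ∀ x, x ∉ S → w x = 0) :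
    FiniteEnergy K w := by
  refine FiniteEnergy.of_sq_le hK hm (H := fun z => C * localWeight S z) ?_
    (Eventually.of_forall fun z => ?_)
  · simpa only [mul_assoc] using (integrable_localWeight hK hS hS').const_mul C
  · by_cases h' : z.1 ∈ S ∨ z.2 ∈ S
    · exact (hw _ _).trans (by gcongr; exact min_le_localWeight h')
    · push Not at h'
      rw [h _ h'.1, h _ h'.2]
      have := localWeight_nonneg S z
      simp; positivity

theorem rpow_neg_sub_le {e a b : ℝ} (he : 0 < e) (ha : 1 ≤ a) (hab : a ≤ b) :
    a ^ (-e) - b ^ (-e) ≤ e * (b - a) := by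
  have ha0 : 0 < a := by linarith
  have hb0 : 0 < b := by linarith
  have hder : ∀ x ∈ Set.Ici (1 : ℝ), HasDerivWithinAt (fun t : ℝ => t ^ (-e))
      (-e * x ^ (-e - 1)) (Set.Ici 1) x := fun x hx =>
    (Real.hasDerivAt_rpow_const (Or.inl (by have : (1:ℝ) ≤ x := hx; positivity))).hasDerivWithinAt
  have := (convex_Ici (1 : ℝ)).norm_image_sub_le_of_norm_hasDerivWithin_le (C := e) hder
    (fun x hx => by
      have hx1 : (1 : ℝ) ≤ x := hx
      rw [Real.norm_eq_abs, abs_mul, abs_neg, abs_of_pos he, abs_of_nonneg (by positivity)]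
      exact mul_le_of_le_one_right he.le (Real.rpow_le_one_of_one_le_of_nonpos hx1 (by linarith)))
    (x := b) (y := a) (ha.trans hab) ha
  rw [Real.norm_eq_abs, Real.norm_eq_abs, abs_sub_comm a b, abs_of_nonneg (by linarith : 0 ≤ b - a)]
    at this
  exact (le_abs_self _).trans this

theorem gammaStar_nonneg (x : Space N) (hR : 1 < R) : 0 ≤ gammaStar N s R x := by
  have : 0 ≤ max ‖x‖ R := by positivity
  unfold gammaStar
  positivity

theorem gammaStar_continuous (hR : 1 < R) : Continuous (gammaStar N s R) := by
  unfold gammaStar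
  refine (continuous_norm.max continuous_const).rpow_const fun x => Or.inl ?_
  have : R ≤ max ‖x‖ R := le_max_right _ _
  intro h; linarith

theorem gammaStar_increments (hN : 2 * s < N) (hR : 1 < R) :
    ∃ C : ℝ, 0 ≤ C ∧ HasBoundedIncrements C (gammaStar N s R) := by
  have he : 0 < (N : ℝ) - 2 * s := by linarith
  refine ⟨((N : ℝ) - 2 * s) ^ 2 + 1 ^ 2, by positivity, HasBoundedIncrements.of_lipschitz ?_ ?_⟩
  · have key : ∀ x y : Space N, ‖x‖ ≤ ‖y‖ → |gammaStar N s R x - gammaStar N s R y|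
        ≤ ((N : ℝ) - 2 * s) * ‖x - y‖ := by
      intro x y hxy
      have hm : max ‖x‖ R ≤ max ‖y‖ R := max_le_max_right _ hxy
      have h1 : 1 ≤ max ‖x‖ R := hR.le.trans (le_max_right _ _)
      unfold gammaStar
      rw [abs_of_nonneg (sub_nonneg.2 (Real.rpow_le_rpow_of_nonpos (by linarith) hm (by linarith)))]
      refine (rpow_neg_sub_le he h1 hm).trans ?_
      gcongr
      calc max ‖y‖ R - max ‖x‖ R ≤ |max ‖y‖ R - max ‖x‖ R| := le_abs_self _
        _ ≤ |‖y‖ - ‖x‖| := abs_max_sub_max_le_abs _ _ _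
        _ ≤ ‖y - x‖ := abs_norm_sub_norm_le _ _
        _ = ‖x - y‖ := norm_sub_rev _ _
    intro x y
    rcases le_total ‖x‖ ‖y‖ with h | h
    · exact key x y h
    · rw [abs_sub_comm, norm_sub_rev]
      exact key y x h
  · have hb : ∀ x : Space N, 0 ≤ gammaStar N s R x ∧ gammaStar N s R x ≤ 1 := fun x =>
      ⟨gammaStar_nonneg x hR, Real.rpow_le_one_of_one_le_of_nonpos
        (hR.le.trans (le_max_right _ _)) (by linarith)⟩
    intro x y
    rw [abs_le]
    constructor <;> linarith [(hb x).1, (hb x).2, (hb y).1, (hb y).2]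

end Form

/-! ### The fractional Sobolev inequality -/

section Sobolev

variable {N : ℕ} {s R : ℝ} {K : Space N → ℝ}

theorem dim_pos (hs0 : 0 < s) (hN : 2 * s < N) : (0 : ℝ) < N := by linarith

theorem two_lt_critExp (hs0 : 0 < s) (hN : 2 * s < N) : 2 < critExp N s := by
  unfold critExp
  rw [lt_div_iff₀ (by linarith)]
  linarith

theorem critExp_mul (hs0 : 0 < s) (hN : 2 * s < N) :
    critExp N s * (2 * s / N) = critExp N s - 2 := by
  have h1 : (N : ℝ) - 2 * s ≠ 0 := by linarith
  have h2 : (N : ℝ) ≠ 0 := (dim_pos hs0 hN).ne'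
  unfold critExp
  field_simp
  ring

/-- Either `a` is at most half of `b` in absolute value, and then `b - a` is at least half of `b`,
or the last term dominates. -/
theorem sq_le_four_sub_sq_add {r b a : ℝ} (hr : 0 ≤ r) (hb : b ≠ 0) :
    b ^ 2 ≤ 4 * (b - a) ^ 2 + b ^ 2 * ((2 / |b|) ^ r * |a| ^ r) := by
  have hb' : 0 < |b| := abs_pos.2 hb
  rcases le_total |a| (|b| / 2) with h | h
  · have h1 : |b| / 2 ≤ |b - a| := by linarith [abs_sub_abs_le_abs_sub b a]
    have h2 : (|b| / 2) ^ 2 ≤ (b - a) ^ 2 := by rw [← sq_abs (b - a)]; gcongr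
    have h3 : 0 ≤ b ^ 2 * ((2 / |b|) ^ r * |a| ^ r) := by positivity
    nlinarith [sq_abs b]
  · have h1 : 1 ≤ (2 / |b|) ^ r * |a| ^ r := by
      rw [← Real.mul_rpow (by positivity) (abs_nonneg a)]
      refine Real.one_le_rpow ?_ hr
      rw [div_mul_eq_mul_div, le_div_iff₀ hb']
      linarith
    nlinarith [sq_nonneg (b - a), sq_nonneg b, mul_le_mul_of_nonneg_left h1 (sq_nonneg b)]

/-- Pointwise form of the Sobolev inequality: `|u(x)|` to the critical power is bounded by the energy
density at `x`. It follows by averaging `(u(x) - u(y))²` over a ball around `x` just large enough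
for `u` to be small, compared with `u(x)`, on half of it. -/
theorem rpow_le_energy_density (hs0 : 0 < s) (hN : 2 * s < N) (hK : KernelAssumptions N s R K) :
    ∃ C : ℝ, 0 < C ∧ ∀ (u : Space N → ℝ) (x : Space N),
      Integrable (fun y => |u y| ^ critExp N s) → 0 < ∫ y, |u y| ^ critExp N s →
      Integrable (fun y => (u x - u y) ^ 2 * K (x - y)) →
      |u x| ^ critExp N s ≤ C * (∫ y, |u y| ^ critExp N s) ^ (2 * s / N) *
        ∫ y, (u x - u y) ^ 2 * K (x - y) := by
  obtain ⟨c, hc, hlow⟩ := hK.lower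
  have hNpos := dim_pos hs0 hN
  have hr2 := two_lt_critExp hs0 hN
  have hrm := critExp_mul hs0 hN
  set r := critExp N s with hr
  set β := volume.real (Metric.ball (0 : Space N) 1) with hβ
  have hβ0 : 0 < β :=
    ENNReal.toReal_pos (Metric.measure_ball_pos _ _ one_pos).ne' measure_ball_lt_top.ne
  refine ⟨8 / (c * β) * (2 ^ (1 + r) / β) ^ (2 * s / N), by positivity, ?_⟩
  intro u x hu hU hg
  set U := ∫ y, |u y| ^ r with hUdef
  set g := ∫ y, (u x - u y) ^ 2 * K (x - y) with hgdef
  have qx : Measure.QuasiMeasurePreserving (fun y : Space N => x - y) :=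
    (Measure.measurePreserving_sub_left volume x).quasiMeasurePreserving
  have hKx : ∀ᵐ y, 0 ≤ K (x - y) := qx.ae hK.ae_nonneg
  have hg0 : 0 ≤ g := integral_nonneg_of_ae <| by
    filter_upwards [hKx] with y hy using mul_nonneg (sq_nonneg _) hy
  by_cases hux : u x = 0
  · rw [hux, abs_zero, Real.zero_rpow (by linarith)]
    positivity
  set t := |u x| with ht
  have htpos : 0 < t := abs_pos.2 hux
  -- the ball of this radius has twice the measure that Chebyshev's inequality allows for the set
  -- where `|u|` exceeds `t / 2`
  set ρ : ℝ := (2 * (2 / t) ^ r * U / β) ^ (1 / (N : ℝ)) with hρ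
  have hρpos : 0 < ρ := by positivity
  have hρN : β * ρ ^ (N : ℝ) = 2 * (2 / t) ^ r * U := by
    rw [hρ, ← Real.rpow_mul (by positivity), one_div_mul_cancel hNpos.ne', Real.rpow_one]
    field_simp
  have hvol : volume.real (Metric.ball x ρ) = β * ρ ^ (N : ℝ) := by
    rw [measureReal_def, Measure.addHaar_ball_of_pos _ _ hρpos, finrank_euclideanSpace_fin,
      ENNReal.toReal_mul, ENNReal.toReal_ofReal (by positivity), hβ, measureReal_def, mul_comm,
      Real.rpow_natCast]
  have hball : t ^ 2 * (β * ρ ^ (N : ℝ)) ≤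
      4 / c * ρ ^ ((N : ℝ) + 2 * s) * g + t ^ 2 * ((2 / t) ^ r * U) := by
    have hB : volume (Metric.ball x ρ) ≠ ⊤ := measure_ball_lt_top.ne
    have i1 : Integrable (fun y => 4 / c * ρ ^ ((N : ℝ) + 2 * s) * ((u x - u y) ^ 2 * K (x - y))) :=
      hg.const_mul _
    have i2 : Integrable (fun y => t ^ 2 * ((2 / t) ^ r * |u y| ^ r)) :=
      (hu.const_mul _).const_mul _
    have step1 : ∫ _ in Metric.ball x ρ, t ^ 2 ≤ ∫ y in Metric.ball x ρ,
        (4 / c * ρ ^ ((N : ℝ) + 2 * s) * ((u x - u y) ^ 2 * K (x - y)) +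
          t ^ 2 * ((2 / t) ^ r * |u y| ^ r)) := by
      refine setIntegral_mono_ae_restrict (integrableOn_const hB) (i1.add i2).integrableOn ?_
      rw [EventuallyLE, ae_restrict_iff' measurableSet_ball]
      filter_upwards [qx.ae hlow] with y hy hyB
      have hb := sq_le_four_sub_sq_add (r := r) (b := u x) (a := u y) (by linarith) hux
      rw [← sq_abs (u x), ← ht] at hb
      refine hb.trans (add_le_add_left ?_ _)
      by_cases hxy : x = y
      · simp [hxy]
      have hd : 0 < ‖x - y‖ := norm_pos_iff.2 (sub_ne_zero.2 hxy)
      have hdρ : ‖x - y‖ ≤ ρ := by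
        rw [Metric.mem_ball, dist_comm, dist_eq_norm] at hyB
        exact hyB.le
      have hk : 1 ≤ 1 / c * ρ ^ ((N : ℝ) + 2 * s) * K (x - y) := by
        calc (1 : ℝ) = 1 / c * ρ ^ ((N : ℝ) + 2 * s) * (c * ρ ^ (-((N : ℝ) + 2 * s))) := by
              rw [Real.rpow_neg hρpos.le]
              field_simp
          _ ≤ 1 / c * ρ ^ ((N : ℝ) + 2 * s) * (c * ‖x - y‖ ^ (-((N : ℝ) + 2 * s))) := by
              gcongr ?_ * (c * ?_)
              exact Real.rpow_le_rpow_of_nonpos hd hdρ (by linarith)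
          _ ≤ _ := by gcongr
      calc 4 * (u x - u y) ^ 2 = 4 * (u x - u y) ^ 2 * 1 := by ring
        _ ≤ 4 * (u x - u y) ^ 2 * (1 / c * ρ ^ ((N : ℝ) + 2 * s) * K (x - y)) := by gcongr
        _ = _ := by ring
    have step2 : ∫ y in Metric.ball x ρ,
        (4 / c * ρ ^ ((N : ℝ) + 2 * s) * ((u x - u y) ^ 2 * K (x - y)) +
          t ^ 2 * ((2 / t) ^ r * |u y| ^ r)) ≤ ∫ y,
        (4 / c * ρ ^ ((N : ℝ) + 2 * s) * ((u x - u y) ^ 2 * K (x - y)) +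
          t ^ 2 * ((2 / t) ^ r * |u y| ^ r)) := by
      refine setIntegral_le_integral (i1.add i2) ?_
      filter_upwards [hKx] with y hy
      simp only [Pi.zero_apply]
      positivity
    rw [integral_add i1 i2, integral_const_mul, integral_const_mul, integral_const_mul] at step2
    rw [setIntegral_const, hvol, smul_eq_mul, mul_comm] at step1
    exact step1.trans step2
  have h1 : t ^ 2 ≤ 8 / (c * β) * ρ ^ (2 * s) * g := by
    have e : (2 / t) ^ r * U = β * ρ ^ (N : ℝ) / 2 := by rw [hρN]; ring
    rw [e, Real.rpow_add hρpos] at hball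
    have hp : 0 < ρ ^ (N : ℝ) := by positivity
    have : t ^ 2 * (β * ρ ^ (N : ℝ) / 2) ≤ (8 / (c * β) * ρ ^ (2 * s) * g) * (β * ρ ^ (N : ℝ) / 2) := by
      have e2 : (8 / (c * β) * ρ ^ (2 * s) * g) * (β * ρ ^ (N : ℝ) / 2)
          = 4 / c * (ρ ^ (N : ℝ) * ρ ^ (2 * s)) * g := by
        field_simp
        ring
      rw [e2]; linarith
    exact le_of_mul_le_mul_right this (by positivity)
  have h2 : ρ ^ (2 * s) = (2 ^ (1 + r) / β) ^ (2 * s / N) * U ^ (2 * s / N) * t ^ (-(r - 2)) := by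
    rw [hρ, ← Real.rpow_mul (by positivity), one_div_mul_eq_div]
    have : 2 * (2 / t) ^ r * U / β = 2 ^ (1 + r) / β * U * t ^ (-r) := by
      rw [Real.div_rpow (by norm_num) htpos.le, Real.rpow_neg htpos.le,
        Real.rpow_add (by norm_num), Real.rpow_one]
      field_simp
    rw [this, Real.mul_rpow (by positivity) (by positivity),
      Real.mul_rpow (by positivity) (by positivity), ← Real.rpow_mul htpos.le, ← hrm, neg_mul]
  calc t ^ r = t ^ 2 * t ^ (r - 2) := by
        rw [← Real.rpow_natCast, ← Real.rpow_add htpos]; norm_num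
    _ ≤ (8 / (c * β) * ρ ^ (2 * s) * g) * t ^ (r - 2) := by gcongr
    _ = 8 / (c * β) * (2 ^ (1 + r) / β) ^ (2 * s / N) * U ^ (2 * s / N) * g := by
        rw [h2, Real.rpow_neg htpos.le]
        field_simp

/-- The fractional Sobolev inequality for `[u,u]`. Integrating the pointwise bound gives
`U ≤ C U^(2s/N) [u,u]` for `U = ∫ |u|^(2^*_s)`, and `U`, being finite, can be absorbed. -/
theorem sobolev (hs0 : 0 < s) (hN : 2 * s < N) (hK : KernelAssumptions N s R K) :
    ∃ S : ℝ, 0 < S ∧ ∀ u : Space N → ℝ,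
      Integrable (fun y => |u y| ^ critExp N s) → FiniteEnergy K u →
      ∫ y, |u y| ^ critExp N s ≤ (S * form K u u) ^ (critExp N s / 2) := by
  obtain ⟨C, hC, h⟩ := rpow_le_energy_density hs0 hN hK
  refine ⟨C, hC, fun u hu hE => ?_⟩
  have hr2 := two_lt_critExp hs0 hN
  have hrm := critExp_mul hs0 hN
  have hD := form_self_nonneg hK u
  set r := critExp N s with hr
  set U := ∫ y, |u y| ^ r with hUdef
  have hU0 : 0 ≤ U := integral_nonneg fun y => by positivity
  rcases hU0.eq_or_lt with hU | hU
  · rw [← hU]; positivity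
  have hE' : Integrable (fun z : Space N × Space N => (u z.1 - u z.2) ^ 2 * K (z.1 - z.2))
    (volume.prod volume) := hE
  have h1 : U ≤ C * U ^ (2 * s / N) * form K u u := by
    rw [form_self, Measure.volume_eq_prod, integral_prod _ hE', ← integral_const_mul]
    refine integral_mono_ae hu (hE'.integral_prod_left.const_mul _) ?_
    filter_upwards [hE'.prod_right_ae] with x hx
    exact h u x hu hU hx
  have h2 : U ^ (2 / r) ≤ C * form K u u := by
    have e : U = U ^ (2 / r) * U ^ (2 * s / N) := by
      rw [← Real.rpow_add hU]
      have : 2 / r + 2 * s / N = 1 := by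
        have : 2 * s / N = (r - 2) / r := by rw [← hrm]; field_simp
        rw [this]; field_simp; ring
      rw [this, Real.rpow_one]
    have hp : 0 < U ^ (2 * s / N) := by positivity
    refine le_of_mul_le_mul_right ?_ hp
    rw [← e]; linarith
  calc U = (U ^ (2 / r)) ^ (r / 2) := by
        rw [← Real.rpow_mul hU0]
        have : 2 / r * (r / 2) = 1 := by field_simp
        rw [this, Real.rpow_one]
    _ ≤ _ := by gcongr

/-- A function of zero energy in `L^{2^*_s}` vanishes. -/
theorem ae_eq_zero_of_form_nonpos (hs0 : 0 < s) (hN : 2 * s < N) (hK : KernelAssumptions N s R K)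
    {u : Space N → ℝ} (hu : Integrable fun y => |u y| ^ critExp N s) (hE : FiniteEnergy K u)
    (h : form K u u ≤ 0) : u =ᵐ[volume] 0 := by
  obtain ⟨S, hS, hsob⟩ := sobolev hs0 hN hK
  have hr2 := two_lt_critExp hs0 hN
  have h0 : form K u u = 0 := le_antisymm h (form_self_nonneg hK u)
  have h1 := hsob u hu hE
  rw [h0, mul_zero, Real.zero_rpow (by linarith)] at h1
  have h2 : ∫ y, |u y| ^ critExp N s = 0 :=
    le_antisymm h1 (integral_nonneg fun y => by positivity)
  rw [integral_eq_zero_iff_of_nonneg (fun y => by positivity) hu] at h2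
  filter_upwards [h2] with y hy
  simp only [Pi.zero_apply] at hy ⊢
  exact abs_eq_zero.1 ((Real.rpow_eq_zero (abs_nonneg _) (by linarith)).1 hy)

end Sobolev

/-! ### De Giorgi iteration -/

section DeGiorgi

theorem rpow_mul_truncation_le {p r M t : ℝ} (hp : 1 ≤ p) (hpr : p < r) (hM : 0 < M) (ht : 0 ≤ t)
    (i : ℕ) :
    t ^ (p - 1) * max (t - M * (2 - (1 / 2) ^ (i + 1))) 0 ≤
      4 ^ r * (2 ^ r) ^ i * M ^ (p - r) * max (t - M * (2 - (1 / 2) ^ i)) 0 ^ r := by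
  set h := M * (2 - (1 / 2) ^ (i + 1)) with hh
  set h' := M * (2 - (1 / 2) ^ i) with hh'
  set d := M * (1 / 2) ^ (i + 1) with hd
  have hdpos : 0 < d := by positivity
  have hd' : h - h' = d := by rw [hh, hh', hd, pow_succ]; ring
  have hpow : (1 / 2 : ℝ) ^ i ≤ 1 := pow_le_one₀ (by norm_num) (by norm_num)
  have hpow0 : (0 : ℝ) < (1 / 2) ^ i := by positivity
  have hh'0 : 0 ≤ h' := by rw [hh']; exact mul_nonneg hM.le (by linarith)
  rcases le_or_gt t h with hth | hth
  · rw [max_eq_right (by linarith : t - h ≤ 0), mul_zero]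
    positivity
  have e1 : d ≤ t - h' := by linarith
  have hpos : 0 < t - h' := by linarith
  have htpos : 0 < t := by linarith
  rw [max_eq_left (by linarith : 0 ≤ t - h), max_eq_left hpos.le]
  have hhM : h ≤ 2 * M := by rw [hh]; nlinarith [pow_pos (show (0:ℝ) < 1 / 2 by norm_num) (i + 1)]
  have hM2 : 2 * M = 2 ^ (i + 2) * d := by
    rw [hd, pow_succ _ (i + 1), one_div, inv_pow]
    field_simp
  -- on the set `h < t` the value `t` is controlled by the increment over the lower level
  have e2 : t ≤ 2 ^ (i + 2) * (t - h') := by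
    have h1 : (1 : ℝ) ≤ 2 ^ (i + 2) := one_le_pow₀ (by norm_num)
    have h2 : h ≤ 2 ^ (i + 2) * d := hhM.trans_eq hM2
    nlinarith
  calc t ^ (p - 1) * (t - h) ≤ t ^ (p - 1) * t := by
        gcongr; have : 0 ≤ h := by linarith
        linarith
    _ = t ^ p := by
        rw [← Real.rpow_add_one htpos.ne']; ring_nf
    _ ≤ (2 ^ (i + 2) * (t - h')) ^ p := by gcongr
    _ = (2 ^ (i + 2)) ^ p * ((t - h') ^ (p - r) * (t - h') ^ r) := by
        rw [Real.mul_rpow (by positivity) hpos.le, ← Real.rpow_add hpos]; ring_nf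
    _ ≤ (2 ^ (i + 2)) ^ p * (d ^ (p - r) * (t - h') ^ r) := by
        gcongr ?_ * (?_ * ?_)
        · exact Real.rpow_le_rpow_of_nonpos hdpos e1 (by linarith)
    _ ≤ (2 ^ (i + 2)) ^ p * ((M ^ (p - r) * (2 ^ (i + 2)) ^ (r - p)) * (t - h') ^ r) := by
        gcongr
        have : d ^ (p - r) = M ^ (p - r) * (2 ^ (i + 1)) ^ (r - p) := by
          rw [hd, Real.mul_rpow hM.le (by positivity), one_div, inv_pow,
            Real.inv_rpow (by positivity), ← Real.rpow_neg (by positivity), neg_sub]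
        rw [this]
        have h3 : 0 ≤ r - p := by linarith
        gcongr <;> norm_num
    _ = ((2 ^ (i + 2)) ^ p * (2 ^ (i + 2)) ^ (r - p)) * M ^ (p - r) * (t - h') ^ r := by ring
    _ = 4 ^ r * (2 ^ r) ^ i * M ^ (p - r) * (t - h') ^ r := by
        rw [← Real.rpow_add (by positivity), add_sub_cancel, pow_add,
          Real.mul_rpow (by positivity) (by positivity), ← Real.rpow_natCast 2 i,
          ← Real.rpow_mul (by norm_num), mul_comm (i : ℝ) r, Real.rpow_mul (by norm_num),
          Real.rpow_natCast, show (2 : ℝ) ^ 2 = 4 by norm_num]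
        ring

/-- Superlinear recursion: `Y_{i+1} ≤ (A bⁱ Y_i)^σ` with `σ > 1` forces `Y_i → 0` if `Y_0` is
small. -/
theorem tendsto_zero_of_superlinear {Y : ℕ → ℝ} {A b σ U : ℝ} (hA : 0 ≤ A) (hb : 1 < b)
    (hσ : 1 < σ) (hU : 0 < U) (hY : ∀ i, 0 ≤ Y i) (h0 : Y 0 ≤ U)
    (hrec : ∀ i, Y (i + 1) ≤ (A * b ^ i * Y i) ^ σ)
    (hsmall : A ^ σ * U ^ (σ - 1) ≤ b ^ (-(σ / (σ - 1)))) :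
    Tendsto Y atTop (𝓝 0) := by
  have hb0 : 0 < b := by linarith
  set τ := b ^ (-(σ / (σ - 1))) with hτ
  have hτ0 : 0 < τ := by positivity
  have hτ1 : τ < 1 := Real.rpow_lt_one_of_one_lt_of_neg hb (by
    have : 0 < σ / (σ - 1) := div_pos (by linarith) (by linarith)
    linarith)
  have hbτ : b ^ σ * τ ^ (σ - 1) = 1 := by
    rw [hτ, ← Real.rpow_mul hb0.le, ← Real.rpow_add hb0]
    have : σ + -(σ / (σ - 1)) * (σ - 1) = 0 := by
      have : σ - 1 ≠ 0 := by linarith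
      field_simp; ring
    rw [this, Real.rpow_zero]
  have hbound : ∀ i, Y i ≤ U * τ ^ i := by
    intro i
    induction i with
    | zero => simpa using h0
    | succ i ih =>
      calc Y (i + 1) ≤ (A * b ^ i * Y i) ^ σ := hrec i
        _ ≤ (A * b ^ i * (U * τ ^ i)) ^ σ := by
            have := hY i
            gcongr
        _ = A ^ σ * U ^ (σ - 1) * (b ^ σ * τ ^ (σ - 1)) ^ i * (U * τ ^ i) := by
            have e1 : U ^ σ = U ^ (σ - 1) * U := by
              rw [← Real.rpow_add_one hU.ne']; ring_nf
            have e2 : (τ ^ i) ^ σ = (τ ^ (σ - 1)) ^ i * τ ^ i := by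
              rw [← Real.rpow_natCast, ← Real.rpow_mul hτ0.le, ← Real.rpow_natCast (τ ^ (σ - 1)),
                ← Real.rpow_mul hτ0.le, ← Real.rpow_add hτ0]
              ring_nf
            have e3 : (b ^ i) ^ σ = (b ^ σ) ^ i := by
              rw [← Real.rpow_natCast, ← Real.rpow_mul hb0.le, ← Real.rpow_natCast (b ^ σ),
                ← Real.rpow_mul hb0.le, mul_comm]
            rw [Real.mul_rpow (by positivity) (by positivity),
              Real.mul_rpow (by positivity) (by positivity),
              Real.mul_rpow (by positivity) (by positivity), e1, e2, e3, mul_pow]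
            ring
        _ ≤ τ * (U * τ ^ i) := by
            rw [hbτ, one_pow, mul_one]
            gcongr
        _ = U * τ ^ (i + 1) := by ring
  refine squeeze_zero hY hbound ?_
  simpa using (tendsto_pow_atTop_nhds_zero_of_lt_one hτ0.le hτ1).const_mul U

/-- De Giorgi's boundedness criterion: a reverse inequality for the truncations `(u - h)⁺` at all
levels `h ≥ M` bounds `u` by `2M`, provided `M` is large compared with `∫ uʳ`. -/
theorem ae_le_of_truncation_estimate {X : Type*} [MeasurableSpace X] {μ : Measure X} {u : X → ℝ}
    {p r M B U : ℝ} (hum : AEStronglyMeasurable u μ) (hu0 : ∀ᵐ x ∂μ, 0 ≤ u x)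
    (hui : Integrable (fun x => |u x| ^ r) μ) (hp : 1 ≤ p) (hpr : p < r) (hr : 2 < r)
    (hM : 0 < M) (hB : 0 ≤ B) (hU : 0 < U) (huU : ∫ x, |u x| ^ r ∂μ ≤ U)
    (hest : ∀ h, M ≤ h → ∫ x, max (u x - h) 0 ^ r ∂μ ≤
      (B * ∫ x, u x ^ (p - 1) * max (u x - h) 0 ∂μ) ^ (r / 2))
    (hsmall : (4 ^ r * B * M ^ (p - r)) ^ (r / 2) * U ^ (r / 2 - 1) ≤
      (2 ^ r : ℝ) ^ (-((r / 2) / (r / 2 - 1)))) :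
    ∀ᵐ x ∂μ, u x ≤ 2 * M := by
  have hr0 : 0 < r := by linarith
  have hle : ∀ h, 0 ≤ h → ∀ᵐ x ∂μ, max (u x - h) 0 ^ r ≤ |u x| ^ r := by
    intro h hh
    filter_upwards [hu0] with x hx
    gcongr
    exact max_le (by linarith [le_abs_self (u x)]) (abs_nonneg _)
  have hint : ∀ h, 0 ≤ h → Integrable (fun x => max (u x - h) 0 ^ r) μ := by
    intro h hh
    refine hui.mono' ?_ ?_
    · exact ((((hum.aemeasurable.sub_const h).max aemeasurable_const)).pow_const r).aestronglyMeasurable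
    · filter_upwards [hle h hh] with x hx
      rwa [Real.norm_of_nonneg (by positivity)]
  set Y : ℕ → ℝ := fun i => ∫ x, max (u x - M * (2 - (1 / 2) ^ i)) 0 ^ r ∂μ with hYdef
  have hlev : ∀ i : ℕ, M ≤ M * (2 - (1 / 2) ^ i) ∧ M * (2 - (1 / 2) ^ i) ≤ 2 * M := by
    intro i
    have h1 : (1 / 2 : ℝ) ^ i ≤ 1 := pow_le_one₀ (by norm_num) (by norm_num)
    have h2 : (0 : ℝ) < (1 / 2) ^ i := by positivity
    constructor <;> nlinarith
  have hY0 : ∀ i, 0 ≤ Y i := fun i => integral_nonneg fun x => by positivity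
  have hlim : Tendsto Y atTop (𝓝 0) := by
    refine tendsto_zero_of_superlinear (A := 4 ^ r * B * M ^ (p - r)) (b := 2 ^ r) (σ := r / 2)
      (U := U) (by positivity) (Real.one_lt_rpow (by norm_num) hr0) (by linarith) hU hY0 ?_ ?_ hsmall
    · refine (integral_mono_ae (hint _ (by linarith [(hlev 0).1])) hui
        (hle _ (by linarith [(hlev 0).1]))).trans huU
    · intro i
      refine (hest _ (hlev (i + 1)).1).trans ?_
      have hi0 : 0 ≤ ∫ x, u x ^ (p - 1) * max (u x - M * (2 - (1 / 2) ^ (i + 1))) 0 ∂μ := by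
        refine integral_nonneg_of_ae ?_
        filter_upwards [hu0] with x hx
        simp only [Pi.zero_apply]
        positivity
      have hmono : ∫ x, u x ^ (p - 1) * max (u x - M * (2 - (1 / 2) ^ (i + 1))) 0 ∂μ ≤
          4 ^ r * (2 ^ r) ^ i * M ^ (p - r) * Y i := by
        rw [hYdef, ← integral_const_mul]
        refine integral_mono_of_nonneg ?_ ((hint _ (by linarith [(hlev i).1])).const_mul _) ?_
        · filter_upwards [hu0] with x hx
          simp only [Pi.zero_apply]
          positivity
        · filter_upwards [hu0] with x hx
          exact rpow_mul_truncation_le hp hpr hM hx i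
      refine Real.rpow_le_rpow (mul_nonneg hB hi0) ?_ (by linarith)
      calc _ ≤ B * (4 ^ r * (2 ^ r) ^ i * M ^ (p - r) * Y i) := by gcongr
        _ = _ := by ring
  have hzero : ∫ x, max (u x - 2 * M) 0 ^ r ∂μ = 0 := by
    refine le_antisymm ?_ (integral_nonneg fun x => by positivity)
    refine ge_of_tendsto' hlim fun i => ?_
    refine integral_mono (hint _ (by linarith)) (hint _ (by linarith [(hlev i).1])) fun x => ?_
    have := (hlev i).2
    dsimp only
    gcongr
  rw [integral_eq_zero_iff_of_nonneg (fun x => by positivity) (hint _ (by linarith))] at hzero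
  filter_upwards [hzero] with x hx
  have h1 : max (u x - 2 * M) 0 = 0 :=
    (Real.rpow_eq_zero (le_max_right _ _) hr0.ne').1 hx
  have := le_max_left (u x - 2 * M) 0
  linarith

end DeGiorgi

/-! ### The truncated nonlinearity -/

section Nonlinearity

variable {N : ℕ} {s p q θ R lam : ℝ} {f : ℝ → ℝ} {V : Space N → ℝ} {k : ℕ}

theorem NonlinearityAssumptions.nonneg' (hf : NonlinearityAssumptions N s p θ f) (t : ℝ) :
    0 ≤ f t := by
  rcases le_or_gt t 0 with h | h
  · exact (hf.eq_zero t h).ge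
  · exact hf.nonneg t h

theorem NonlinearityAssumptions.growth (hf : NonlinearityAssumptions N s p θ f) :
    ∃ C : ℝ, 1 ≤ C ∧ ∀ t, 0 ≤ t → f t ≤ C * t ^ (p - 1) := by
  obtain ⟨C₁, h₁⟩ := hf.limsup_zero
  obtain ⟨C₂, h₂⟩ := hf.limsup_top
  have hp := hf.two_lt_p
  have hpr := hf.p_lt
  rw [eventually_map] at h₁ h₂
  obtain ⟨a, ha, h₁⟩ := mem_nhdsGT_iff_exists_Ioo_subset.1 h₁
  obtain ⟨b, h₂⟩ := eventually_atTop.1 h₂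
  have ha0 : (0 : ℝ) < a := ha
  -- on a compact interval away from zero the quotient is continuous
  have hcont : ContinuousOn (fun t => f t / t ^ (p - 1)) (Set.Icc a (max a b)) := by
    refine hf.continuous.continuousOn.div
      (continuousOn_id.rpow_const fun t ht => Or.inr (by linarith)) fun t ht => ?_
    have : 0 < t := ha0.trans_le ht.1
    positivity
  obtain ⟨C₃, h₃⟩ := (isCompact_Icc.image_of_continuousOn hcont).bddAbove
  refine ⟨max 1 (max (|C₁| * a ^ (critExp N s - p)) (max C₂ C₃)), le_max_left _ _, ?_⟩
  intro t ht
  rcases ht.eq_or_lt with rfl | ht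
  · rw [hf.eq_zero 0 le_rfl]; positivity
  have htp : 0 < t ^ (p - 1) := by positivity
  rcases lt_or_ge t a with hta | hta
  · have h := h₁ (show t ∈ Set.Ioo 0 a from ⟨ht, hta⟩)
    replace h : f t / t ^ (critExp N s - 1) ≤ C₁ := h
    rw [div_le_iff₀ (by positivity)] at h
    calc f t ≤ C₁ * t ^ (critExp N s - 1) := h
      _ ≤ |C₁| * (t ^ (critExp N s - p) * t ^ (p - 1)) := by
          rw [← Real.rpow_add ht, show critExp N s - p + (p - 1) = critExp N s - 1 by ring]
          gcongr
          exact le_abs_self _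
      _ ≤ (|C₁| * a ^ (critExp N s - p)) * t ^ (p - 1) := by
          rw [← mul_assoc]
          have : 0 ≤ critExp N s - p := by linarith
          gcongr
      _ ≤ _ := by
          gcongr
          exact (le_max_left _ _).trans (le_max_right _ _)
  · rcases le_total t (max a b) with htb | htb
    · have h := h₃ (Set.mem_image_of_mem _ (show t ∈ Set.Icc a (max a b) from ⟨hta, htb⟩))
      rw [div_le_iff₀ htp] at h
      refine h.trans ?_
      gcongr
      exact (le_max_right _ _).trans ((le_max_right _ _).trans (le_max_right _ _))
    · have h : f t / t ^ (p - 1) ≤ C₂ := h₂ t ((le_max_right _ _).trans htb)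
      rw [div_le_iff₀ htp] at h
      refine h.trans ?_
      gcongr
      exact (le_max_left _ _).trans ((le_max_right _ _).trans (le_max_right _ _))

/-- A single formula for the truncated nonlinearity: the power `λ t^(q-1)` is frozen to
`λ t^(p-1) min(t,k)^(q-p)`. -/
theorem fTrunc_eq (hf : NonlinearityAssumptions N s p θ f) (hpq : p < q) (t : ℝ) :
    fTrunc f p q lam k t = f t + lam * (max t 0 ^ (p - 1) * min (max t 0) k ^ (q - p)) := by
  have hp := hf.two_lt_p
  unfold fTrunc
  split_ifs with h1 h2
  · rw [hf.eq_zero t h1.le, max_eq_right h1.le, Real.zero_rpow (by linarith)]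
    simp
  · push Not at h1
    rw [max_eq_left h1, min_eq_left h2, ← Real.rpow_add_of_nonneg h1 (by linarith) (by linarith)]
    ring_nf
  · push Not at h1 h2
    rw [max_eq_left h1, min_eq_right h2.le]
    ring

theorem fTrunc_continuous (hf : NonlinearityAssumptions N s p θ f) (hpq : p < q) :
    Continuous (fTrunc f p q lam k) := by
  have hp := hf.two_lt_p
  have : fTrunc f p q lam k = fun t =>
      f t + lam * (max t 0 ^ (p - 1) * min (max t 0) (k : ℝ) ^ (q - p)) :=
    funext fun t => fTrunc_eq hf hpq t
  rw [this]
  have h0 : Continuous fun t : ℝ => max t 0 := continuous_id.max continuous_const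
  refine hf.continuous.add (continuous_const.mul ((h0.rpow_const fun t => Or.inr ?_).mul
    ((h0.min continuous_const).rpow_const fun t => Or.inr ?_))) <;> linarith

theorem le_fTrunc (hf : NonlinearityAssumptions N s p θ f) (hpq : p < q) (hl : 0 < lam) (t : ℝ) :
    f t ≤ fTrunc f p q lam k t := by
  rw [fTrunc_eq hf hpq]
  have : 0 ≤ lam * (max t 0 ^ (p - 1) * min (max t 0) (k : ℝ) ^ (q - p)) := by positivity
  linarith

theorem fTrunc_nonneg (hf : NonlinearityAssumptions N s p θ f) (hpq : p < q) (hl : 0 < lam)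
    (t : ℝ) : 0 ≤ fTrunc f p q lam k t :=
  (hf.nonneg' t).trans (le_fTrunc hf hpq hl t)

theorem fTrunc_of_nonpos (hf : NonlinearityAssumptions N s p θ f) (hpq : p < q) {t : ℝ}
    (ht : t ≤ 0) : fTrunc f p q lam k t = 0 := by
  have hp := hf.two_lt_p
  rw [fTrunc_eq hf hpq, hf.eq_zero t ht, max_eq_right ht, Real.zero_rpow (by linarith)]
  simp

theorem fTrunc_le (hf : NonlinearityAssumptions N s p θ f) (hpq : p < q) (hl : 0 < lam)
    {C : ℝ} (hC1 : 1 ≤ C) (hC : ∀ t, 0 ≤ t → f t ≤ C * t ^ (p - 1)) {t : ℝ} (ht : 0 ≤ t) :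
    fTrunc f p q lam k t ≤ C * (1 + lam * (k : ℝ) ^ (q - p)) * t ^ (p - 1) := by
  rw [fTrunc_eq hf hpq, max_eq_left ht]
  have h1 : min t (k : ℝ) ^ (q - p) ≤ (k : ℝ) ^ (q - p) := by
    have : 0 ≤ q - p := by linarith
    gcongr
    exact min_le_right _ _
  have htp : 0 ≤ t ^ (p - 1) := by positivity
  have hkp : 0 ≤ lam * (k : ℝ) ^ (q - p) := by positivity
  calc f t + lam * (t ^ (p - 1) * min t (k : ℝ) ^ (q - p))
      ≤ C * t ^ (p - 1) + lam * (t ^ (p - 1) * (k : ℝ) ^ (q - p)) := by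
        gcongr
        exact hC t ht
    _ = (C + 1 * (lam * (k : ℝ) ^ (q - p))) * t ^ (p - 1) := by ring
    _ ≤ (C + C * (lam * (k : ℝ) ^ (q - p))) * t ^ (p - 1) := by gcongr
    _ = _ := by ring

theorem gAux_of_nonpos (hf : NonlinearityAssumptions N s p θ f) (hpq : p < q) (x : Space N) {t : ℝ}
    (ht : t ≤ 0) : gAux f V p q θ R lam k x t = 0 := by
  unfold gAux fBar
  have h0 := fTrunc_of_nonpos (lam := lam) (k := k) hf hpq ht
  rcases ht.lt_or_eq with h | h
  · simp [h0, h]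
  · subst h
    simp [h0]

theorem gAux_nonneg (hf : NonlinearityAssumptions N s p θ f) (hpq : p < q) (hl : 0 < lam)
    {x : Space N} (hx : 0 ≤ V x) (t : ℝ) : 0 ≤ gAux f V p q θ R lam k x t := by
  have h0 := fTrunc_nonneg (k := k) hf hpq hl t
  have hθ : 0 < θ - 2 := by linarith [hf.two_lt_θ]
  have hθ' : 0 < θ := by linarith
  unfold gAux fBar
  split_ifs with h1 h2 h3
  · exact h0
  · exact le_rfl
  · exact h0
  · push Not at h2
    positivity

theorem gAux_le_fTrunc (hf : NonlinearityAssumptions N s p θ f) (x : Space N) {t : ℝ}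
    (ht : 0 ≤ t) : gAux f V p q θ R lam k x t ≤ fTrunc f p q lam k t := by
  have hθ : 0 < θ - 2 := by linarith [hf.two_lt_θ]
  have hν : 0 < 2 * θ / (θ - 2) := div_pos (by linarith) hθ
  unfold gAux fBar
  split_ifs with h1 h2 h3
  · exact le_rfl
  · linarith
  · exact le_rfl
  · push Not at h3
    rw [one_div, mul_assoc, inv_mul_le_iff₀ hν]
    exact h3.le

theorem gAux_le_potential (hf : NonlinearityAssumptions N s p θ f) {x : Space N} (hx : R < ‖x‖)
    {t : ℝ} (ht : 0 ≤ t) : gAux f V p q θ R lam k x t ≤ (θ - 2) / (2 * θ) * (V x * t) := by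
  have hθ : 0 < θ - 2 := by linarith [hf.two_lt_θ]
  have hν : 0 < 2 * θ / (θ - 2) := div_pos (by linarith) hθ
  rw [← inv_div]
  unfold gAux fBar
  split_ifs with h1 h2 h3
  · linarith
  · linarith
  · rwa [← div_eq_inv_mul, le_div_iff₀' hν]
  · rw [one_div, mul_assoc]

theorem primitive_of_nonpos {h : ℝ → ℝ} (hh : ∀ t ≤ 0, h t = 0) {t : ℝ} (ht : t ≤ 0) :
    primitive h t = 0 := by
  unfold primitive
  rw [intervalIntegral.integral_symm, intervalIntegral.integral_of_le ht,
    setIntegral_eq_zero_of_forall_eq_zero (fun x hx => hh x hx.2), neg_zero]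

theorem primitive_nonneg {h : ℝ → ℝ} (hh : ∀ t ≤ 0, h t = 0) (h0 : ∀ t, 0 ≤ h t) (t : ℝ) :
    0 ≤ primitive h t := by
  rcases le_total t 0 with ht | ht
  · exact (primitive_of_nonpos hh ht).ge
  · exact intervalIntegral.integral_nonneg ht fun x _ => h0 x

theorem primitive_mono {h₁ h₂ : ℝ → ℝ} (hi : Continuous h₁) (hi' : Continuous h₂)
    (hle : ∀ t, h₁ t ≤ h₂ t) {t : ℝ} (ht : 0 ≤ t) : primitive h₁ t ≤ primitive h₂ t :=
  intervalIntegral.integral_mono ht (hi.intervalIntegrable _ _) (hi'.intervalIntegrable _ _) hle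

/-- The Ambrosetti–Rabinowitz condition is inherited by the truncated nonlinearity. -/
theorem mul_primitive_fTrunc_le (hf : NonlinearityAssumptions N s p θ f) (hpq : p < q)
    (hl : 0 < lam) (t : ℝ) :
    θ * primitive (fTrunc f p q lam k) t ≤ t * fTrunc f p q lam k t := by
  have hp := hf.two_lt_p
  have hθ := hf.two_lt_θ
  have hθp := hf.θ_lt
  rcases le_total t 0 with ht | ht
  · rw [primitive_of_nonpos (fun t ht => fTrunc_of_nonpos hf hpq ht) ht,
      fTrunc_of_nonpos hf hpq ht]
    simp
  have hqp : 0 ≤ q - p := by linarith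
  set c := lam * min t (k : ℝ) ^ (q - p) with hc
  have hc0 : 0 ≤ c := by positivity
  have hpow : Continuous fun τ : ℝ => c * τ ^ (p - 1) :=
    continuous_const.mul (continuous_id.rpow_const fun τ => Or.inr (by linarith))
  have h1 : primitive (fTrunc f p q lam k) t ≤ ∫ τ in (0 : ℝ)..t, (f τ + c * τ ^ (p - 1)) := by
    refine intervalIntegral.integral_mono_on ht ((fTrunc_continuous hf hpq).intervalIntegrable _ _)
      ((hf.continuous.add hpow).intervalIntegrable _ _) fun τ hτ => ?_
    have hτ0 := hτ.1
    have hτt := hτ.2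
    rw [fTrunc_eq hf hpq, max_eq_left hτ0, hc, mul_comm (τ ^ (p - 1)), ← mul_assoc]
    gcongr
  rw [intervalIntegral.integral_add (hf.continuous.intervalIntegrable _ _)
    (hpow.intervalIntegrable _ _), intervalIntegral.integral_const_mul,
    integral_rpow (Or.inl (by linarith)), sub_add_cancel, Real.zero_rpow (by linarith),
    sub_zero] at h1
  have h2 := hf.ambrosetti_rabinowitz t
  unfold primitive at h2
  have hct : 0 ≤ c * t ^ p := by positivity
  have htp : t * t ^ (p - 1) = t ^ p := by
    rw [← Real.rpow_one_add' ht (by linarith)]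
    ring_nf
  rw [fTrunc_eq hf hpq, max_eq_left ht]
  calc θ * primitive (fTrunc f p q lam k) t
      ≤ θ * ((∫ τ in (0 : ℝ)..t, f τ) + c * (t ^ p / p)) := by gcongr
    _ = θ * (∫ τ in (0 : ℝ)..t, f τ) + θ / p * (c * t ^ p) := by ring
    _ ≤ t * f t + 1 * (c * t ^ p) := by
        gcongr
        rw [div_le_one (by linarith)]
        exact hθp.le
    _ = _ := by rw [hc, ← htp]; ring

theorem primitive_gAux_inside (x : Space N) (hx : ‖x‖ ≤ R) (t : ℝ) :
    primitive (gAux f V p q θ R lam k x) t = primitive (fTrunc f p q lam k) t := by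
  have : gAux f V p q θ R lam k x = fTrunc f p q lam k := by
    funext τ
    simp [gAux, hx]
  rw [this]

theorem primitive_gAux_outside (hf : NonlinearityAssumptions N s p θ f) (hpq : p < q)
    (hl : 0 < lam) {x : Space N} (hx : R < ‖x‖) (hV : 0 ≤ V x) (t : ℝ) :
    primitive (gAux f V p q θ R lam k x) t ≤ (θ - 2) / (4 * θ) * (V x * t ^ 2) := by
  have hθ : 0 < θ - 2 := by linarith [hf.two_lt_θ]
  have hθ' : 0 < θ := by linarith
  rcases le_total t 0 with ht | ht
  · rw [primitive_of_nonpos (fun t ht => gAux_of_nonpos hf hpq x ht) ht]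
    positivity
  have hc : Continuous fun τ : ℝ => (θ - 2) / (2 * θ) * (V x * τ) := by fun_prop
  have h1 : primitive (gAux f V p q θ R lam k x) t ≤
      ∫ τ in (0 : ℝ)..t, (θ - 2) / (2 * θ) * (V x * τ) := by
    unfold primitive
    rw [intervalIntegral.integral_of_le ht, intervalIntegral.integral_of_le ht]
    refine integral_mono_of_nonneg (Eventually.of_forall fun τ => gAux_nonneg hf hpq hl hV τ)
      (hc.integrableOn_Ioc) ?_
    rw [EventuallyLE, ae_restrict_iff' measurableSet_Ioc]
    exact Eventually.of_forall fun τ hτ => gAux_le_potential hf hx hτ.1.le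
  refine h1.trans_eq ?_
  rw [intervalIntegral.integral_const_mul, intervalIntegral.integral_const_mul, integral_id]
  field_simp
  ring

/-- The primitive of `f` grows at least like `t^θ`. -/
theorem NonlinearityAssumptions.primitive_growth (hf : NonlinearityAssumptions N s p θ f) :
    ∃ c t₀ : ℝ, 0 < c ∧ 0 < t₀ ∧ ∀ t, t₀ ≤ t → c * t ^ θ ≤ primitive f t := by
  have hd : ∀ t, HasDerivAt (primitive f) (f t) t := fun t =>
    intervalIntegral.integral_hasDerivAt_right (hf.continuous.intervalIntegrable _ _)
      (hf.continuous.stronglyMeasurableAtFilter _ _) hf.continuous.continuousAt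
  obtain ⟨a, ha⟩ : ∃ a, f a ≠ 0 := by
    by_contra! h
    exact hf.ne_zero (funext h)
  have ha0 : 0 < a := by
    by_contra! h
    exact ha (hf.eq_zero a h)
  have hfa : 0 < f a := (hf.nonneg' a).lt_of_ne ha.symm
  have hb : 0 < primitive f a := by
    -- if the primitive vanished at `a`, it would have a minimum there
    refine (primitive_nonneg hf.eq_zero hf.nonneg' a).lt_of_ne fun h => ha ?_
    have hmin : IsLocalMin (primitive f) a := Eventually.of_forall fun t => by
      rw [← h]; exact primitive_nonneg hf.eq_zero hf.nonneg' t
    exact hmin.hasDerivAt_eq_zero (hd a)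
  have hmono : MonotoneOn (fun t => primitive f t * t ^ (-θ)) (Set.Ici a) := by
    refine monotoneOn_of_hasDerivWithinAt_nonneg (convex_Ici a)
      (f' := fun t => f t * t ^ (-θ) + primitive f t * (-θ * t ^ (-θ - 1))) ?_ ?_ ?_
    · intro t ht
      have : 0 < t := ha0.trans_le ht
      exact ((hd t).continuousAt.mul
        (Real.continuousAt_rpow_const _ _ (Or.inl this.ne'))).continuousWithinAt
    · intro t ht
      rw [interior_Ici] at ht
      have : 0 < t := ha0.trans ht
      exact ((hd t).mul (Real.hasDerivAt_rpow_const (Or.inl this.ne'))).hasDerivWithinAt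
    · intro t ht
      rw [interior_Ici] at ht
      have ht0 : 0 < t := ha0.trans ht
      have e : t ^ (-θ) = t ^ (-θ - 1) * t := by
        rw [← Real.rpow_add_one ht0.ne']; ring_nf
      have e' : f t * t ^ (-θ) + primitive f t * (-θ * t ^ (-θ - 1)) =
          t ^ (-θ - 1) * (t * f t - θ * primitive f t) := by rw [e]; ring
      rw [e']
      exact mul_nonneg (by positivity) (by linarith [hf.ambrosetti_rabinowitz t])
  refine ⟨primitive f a * a ^ (-θ), a, by positivity, ha0, fun t ht => ?_⟩
  have ht0 : 0 < t := ha0.trans_le ht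
  have h1 := hmono Set.self_mem_Ici ht ht
  calc primitive f a * a ^ (-θ) * t ^ θ ≤ primitive f t * t ^ (-θ) * t ^ θ := by gcongr
    _ = primitive f t := by
        rw [mul_assoc, ← Real.rpow_add ht0, neg_add_cancel, Real.rpow_zero, mul_one]

end Nonlinearity

/-! ### The energy space -/

section EnergySpace

variable {N : ℕ} {s p q θ R Λ lam : ℝ} {f : ℝ → ℝ} {K V u v : Space N → ℝ} {k : ℕ}

theorem memLp_critExp_iff (hs0 : 0 < s) (hN : 2 * s < N) (hu : AEStronglyMeasurable u) :
    MemLp u (ENNReal.ofReal (critExp N s)) volume ↔ Integrable fun y => |u y| ^ critExp N s := by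
  have hr := two_lt_critExp hs0 hN
  rw [← integrable_norm_rpow_iff hu (by simpa using (by linarith : 0 < critExp N s))
    ENNReal.ofReal_ne_top, ENNReal.toReal_ofReal (by linarith)]
  rfl

theorem MemE.aestronglyMeasurable (hu : MemE s K V u) : AEStronglyMeasurable u :=
  hu.memLp.aestronglyMeasurable

theorem MemE.integrable_rpow (hs0 : 0 < s) (hN : 2 * s < N) (hu : MemE s K V u) :
    Integrable fun y => |u y| ^ critExp N s :=
  (memLp_critExp_iff hs0 hN hu.aestronglyMeasurable).1 hu.memLp

theorem PotentialAssumptions.aestronglyMeasurable (hV : PotentialAssumptions N s R Λ V) :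
    AEStronglyMeasurable V := by
  have h : (⋃ n : ℕ, Metric.closedBall (0 : Space N) n) = Set.univ := Metric.iUnion_closedBall_nat 0
  rw [← Measure.restrict_univ (μ := (volume : Measure (Space N))), ← h,
    aestronglyMeasurable_iUnion_iff]
  exact fun n => (hV.locally_bounded _ (isCompact_closedBall _ _)).aestronglyMeasurable

theorem PotentialAssumptions.integrable_of_sq_le (hV : PotentialAssumptions N s R Λ V)
    (hu : Integrable fun x => V x * u x ^ 2) {w : Space N → ℝ} (hw : AEStronglyMeasurable w)
    (h : ∀ᵐ x, |w x| ≤ u x ^ 2) : Integrable fun x => V x * w x := by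
  refine hu.mono' (hV.aestronglyMeasurable.mul hw) ?_
  filter_upwards [h, hV.nonneg] with x hx hVx
  rw [Real.norm_eq_abs, abs_mul, abs_of_nonneg hVx]
  exact mul_le_mul_of_nonneg_left hx hVx

/-- A function of finite energy dominated by an element of `E` belongs to `E`. -/
theorem MemE.of_abs_le (hV : PotentialAssumptions N s R Λ V) (hu : MemE s K V u)
    (hv : AEStronglyMeasurable v) (hE : FiniteEnergy K v) (h : ∀ᵐ x, |v x| ≤ |u x|) :
    MemE s K V v where
  memLp := hu.memLp.mono hv h
  finite_form := hE
  finite_potential := by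
    refine hV.integrable_of_sq_le hu.finite_potential (hv.pow 2) ?_
    filter_upwards [h] with x hx
    rw [abs_of_nonneg (sq_nonneg _)]
    exact sq_le_sq.2 hx

/-- `E` is stable under composition with `1`-Lipschitz functions vanishing at the origin. -/
theorem MemE.comp_lipschitz (hK : KernelAssumptions N s R K) (hV : PotentialAssumptions N s R Λ V)
    (hu : MemE s K V u) {φ : ℝ → ℝ} (hφ : ∀ a b, |φ a - φ b| ≤ |a - b|) (h0 : φ 0 = 0) :
    MemE s K V fun x => φ (u x) := by
  have hc : Continuous φ := (LipschitzWith.of_dist_le_mul (K := 1) fun a b => by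
    simpa [Real.dist_eq] using hφ a b).continuous
  have hm : AEStronglyMeasurable fun x => φ (u x) :=
    hc.comp_aestronglyMeasurable hu.aestronglyMeasurable
  refine hu.of_abs_le hV hm (FiniteEnergy.of_sq_le hK hm hu.finite_form
    (Eventually.of_forall fun z => ?_)) (Eventually.of_forall fun x => ?_)
  · exact sq_le_sq.2 (hφ _ _)
  · simpa [h0] using hφ (u x) 0

theorem innerE_self_eq : innerE K V u u = form K u u + ∫ x, V x * u x ^ 2 := by
  simp only [innerE, mul_assoc, sq]

theorem integral_potential_nonneg (hV : PotentialAssumptions N s R Λ V) (u : Space N → ℝ) :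
    0 ≤ ∫ x, V x * u x ^ 2 :=
  integral_nonneg_of_ae <| by
    filter_upwards [hV.nonneg] with x hx using mul_nonneg hx (sq_nonneg _)

theorem innerE_self_nonneg (hK : KernelAssumptions N s R K) (hV : PotentialAssumptions N s R Λ V)
    (u : Space N → ℝ) : 0 ≤ innerE K V u u := by
  rw [innerE_self_eq]
  exact add_nonneg (form_self_nonneg hK u) (integral_potential_nonneg hV u)

theorem normE_sq (hK : KernelAssumptions N s R K) (hV : PotentialAssumptions N s R Λ V)
    (u : Space N → ℝ) : normE K V u ^ 2 = innerE K V u u :=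
  Real.sq_sqrt (innerE_self_nonneg hK hV u)

theorem MemE.const_mul (hu : MemE s K V u) (c : ℝ) : MemE s K V fun x => c * u x where
  memLp := hu.memLp.const_mul c
  finite_form := by
    refine (hu.finite_form.const_mul (c ^ 2)).congr (Eventually.of_forall fun z => ?_)
    simp only
    ring
  finite_potential := by
    refine (hu.finite_potential.const_mul (c ^ 2)).congr (Eventually.of_forall fun z => ?_)
    simp only
    ring

theorem innerE_const_mul (c : ℝ) :
    innerE K V (fun x => c * u x) (fun x => c * u x) = c ^ 2 * innerE K V u u := by
  rw [innerE_self_eq, innerE_self_eq, form_self, form_self, mul_add, ← integral_const_mul,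
    ← integral_const_mul]
  congr 1 <;> congr 1 <;> funext z <;> ring

theorem normE_const_mul (c : ℝ) :
    normE K V (fun x => c * u x) = |c| * normE K V u := by
  rw [normE, innerE_const_mul, Real.sqrt_mul (sq_nonneg c), Real.sqrt_sq_eq_abs, normE]

end EnergySpace

/-! ### A bound for the minimax level -/

section Minimax

variable {N : ℕ} {s p q θ R Λ lam : ℝ} {f : ℝ → ℝ} {K V : Space N → ℝ} {k : ℕ}

/-- The tent of height one over the ball of radius `R`. -/
noncomputable def tent (R : ℝ) (x : Space N) : ℝ := max 0 (1 - ‖x‖ / R)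

theorem tent_continuous : Continuous (tent R : Space N → ℝ) := by
  unfold tent
  fun_prop

theorem tent_eq_zero (hR : 0 < R) {x : Space N} (hx : R ≤ ‖x‖) : tent R x = 0 := by
  have : 1 ≤ ‖x‖ / R := by rwa [le_div_iff₀ hR, one_mul]
  exact max_eq_left (by linarith)

theorem tent_eq_zero_of_notMem (hR : 0 < R) {x : Space N} (hx : x ∉ Metric.closedBall 0 R) :
    tent R x = 0 := by
  rw [mem_closedBall_zero_iff, not_le] at hx
  exact tent_eq_zero hR hx.le

theorem tent_nonneg (x : Space N) : 0 ≤ tent R x := le_max_left _ _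

theorem tent_increments (hR : 1 < R) :
    HasBoundedIncrements (1 ^ 2 + 1 ^ 2) (tent R : Space N → ℝ) := by
  have hR0 : 0 < R := by linarith
  refine HasBoundedIncrements.of_lipschitz (fun x y => ?_) (fun x y => ?_)
  · calc |tent R x - tent R y| ≤ |(1 - ‖x‖ / R) - (1 - ‖y‖ / R)| := by
          unfold tent
          simpa [max_comm] using abs_max_sub_max_le_abs (1 - ‖x‖ / R) (1 - ‖y‖ / R) 0
      _ = |‖y‖ - ‖x‖| / R := by
          rw [← abs_of_pos hR0, ← abs_div, abs_of_pos hR0]; ring_nf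
      _ ≤ |‖y‖ - ‖x‖| := div_le_self (abs_nonneg _) hR.le
      _ ≤ ‖y - x‖ := abs_norm_sub_norm_le _ _
      _ = 1 * ‖x - y‖ := by rw [one_mul, norm_sub_rev]
  · have hb : ∀ x : Space N, tent R x ≤ 1 := fun x => by
      have : 0 ≤ ‖x‖ / R := by positivity
      exact max_le zero_le_one (by linarith)
    rw [abs_le]
    constructor <;> linarith [hb x, hb y, tent_nonneg (R := R) x, tent_nonneg (R := R) y]

theorem tent_memE (hK : KernelAssumptions N s R K) (hV : PotentialAssumptions N s R Λ V) :
    MemE s K V (tent R) := by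
  have hR := hV.one_lt_R
  have hR0 : 0 < R := by linarith
  have hcs : HasCompactSupport (tent R : Space N → ℝ) :=
    HasCompactSupport.intro (isCompact_closedBall 0 R) fun x hx => tent_eq_zero_of_notMem hR0 hx
  refine ⟨tent_continuous.memLp_of_hasCompactSupport hcs, ?_, ?_⟩
  · exact (tent_increments hR).finiteEnergy hK (by norm_num)
      tent_continuous.aestronglyMeasurable measurableSet_closedBall measure_closedBall_lt_top.ne
      fun x hx => tent_eq_zero_of_notMem hR0 hx
  · have h1 : IntegrableOn V (Metric.closedBall 0 R) := by
      have : IsFiniteMeasure (volume.restrict (Metric.closedBall (0 : Space N) R)) :=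
        ⟨by rw [Measure.restrict_apply_univ]; exact measure_closedBall_lt_top⟩
      exact (hV.locally_bounded _ (isCompact_closedBall 0 R)).integrable le_top
    have h2 : IntegrableOn (fun x => V x * tent R x ^ 2) (Metric.closedBall 0 R) :=
      h1.mul_continuousOn (tent_continuous.pow 2).continuousOn (isCompact_closedBall 0 R)
    refine (integrableOn_iff_integrable_of_support_subset fun x hx => ?_).1 h2
    by_contra hx'
    simp [tent_eq_zero_of_notMem hR0 hx'] at hx

theorem integral_primitive_tent (hR : 0 < R) (a : ℝ) :
    ∫ x : Space N, primitive (gAux f V p q θ R lam k x) (a * tent R x) =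
      ∫ x in Metric.closedBall (0 : Space N) R, primitive (fTrunc f p q lam k) (a * tent R x) := by
  have h0 : ∀ x : Space N, x ∉ Metric.closedBall 0 R →
      primitive (fTrunc f p q lam k) (a * tent R x) = 0 := fun x hx => by
    simp [tent_eq_zero_of_notMem hR hx, primitive]
  rw [setIntegral_eq_integral_of_forall_compl_eq_zero h0]
  congr 1
  funext x
  by_cases hx : ‖x‖ ≤ R
  · exact primitive_gAux_inside x hx _
  · rw [h0 x (by rwa [mem_closedBall_zero_iff])]
    simp [tent_eq_zero hR (not_le.1 hx).le, primitive]

theorem primitive_continuous {h : ℝ → ℝ} (hh : Continuous h) : Continuous (primitive h) :=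
  intervalIntegral.continuous_primitive (fun _ _ => hh.intervalIntegrable _ _) 0

/-- The minimax levels are bounded independently of `λ` and `k`: on multiples of the tent the
energy lies below the one with `F` in place of the truncated primitive. -/
theorem exists_minimaxLevel_le (hK : KernelAssumptions N s R K)
    (hV : PotentialAssumptions N s R Λ V) (hf : NonlinearityAssumptions N s p θ f)
    (hpq : p < q) :
    ∃ c₀ : ℝ, 0 ≤ c₀ ∧ ∀ lam : ℝ, 0 < lam → ∀ k : ℕ,
      minimaxLevel s K V (energy f K V p q θ R lam k) ≤ c₀ := by
  have hR := hV.one_lt_R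
  have hR0 : 0 < R := by linarith
  have hθ := hf.two_lt_θ
  obtain ⟨c, t₀, hc, ht₀, hF⟩ := hf.primitive_growth
  set I := innerE K V (tent R) (tent R) with hI
  have hI0 : 0 ≤ I := innerE_self_nonneg hK hV _
  set b := volume.real (Metric.closedBall (0 : Space N) (R / 2)) with hb
  have hb0 : 0 < b := ENNReal.toReal_pos
    (Metric.measure_closedBall_pos _ _ (by positivity)).ne' measure_closedBall_lt_top.ne
  obtain ⟨T, hT1, hT2⟩ := (((tendsto_rpow_atTop (show 0 < θ - 2 by linarith)).eventually_gt_atTop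
    (I / (2 * (c * (1 / 2) ^ θ * b)))).and (eventually_ge_atTop (2 * t₀))).exists
  have hT0 : 0 < T := by linarith
  have hlow : 1 / 2 * (T ^ 2 * I) < c * (T / 2) ^ θ * b := by
    rw [div_lt_iff₀ (by positivity)] at hT1
    have e : c * (T / 2) ^ θ * b = T ^ 2 * (T ^ (θ - 2) * (c * (1 / 2) ^ θ * b)) := by
      have : T ^ θ = T ^ (θ - 2) * T ^ 2 := by
        rw [← Real.rpow_natCast T 2, ← Real.rpow_add hT0]; norm_num
      rw [div_eq_mul_one_div T 2, Real.mul_rpow hT0.le (by norm_num), this]; ring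
    rw [e]
    have : 0 < T ^ 2 := by positivity
    nlinarith
  refine ⟨1 / 2 * (T ^ 2 * I), by positivity, fun lam hl k => ?_⟩
  set J := energy f K V p q θ R lam k with hJ
  set γ : unitInterval → Space N → ℝ := fun t x => (t * T) * tent R x with hγ
  set Φ := primitive (fTrunc f p q lam k) with hΦ
  have hΦc : Continuous Φ := primitive_continuous (fTrunc_continuous hf hpq)
  have hΦ0 : ∀ t, 0 ≤ Φ t := fun t =>
    primitive_nonneg (fun t ht => fTrunc_of_nonpos hf hpq ht) (fTrunc_nonneg hf hpq hl) t
  have hJγ : ∀ t : unitInterval, J (γ t) = 1 / 2 * ((t * T) ^ 2 * I) -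
      ∫ x in Metric.closedBall (0 : Space N) R, Φ ((t * T) * tent R x) := by
    intro t
    rw [hJ, energy, normE_sq hK hV, hγ]
    simp only
    rw [innerE_const_mul, integral_primitive_tent hR0]
  have hJc : Continuous fun t => J (γ t) := by
    simp only [hJγ]
    refine Continuous.sub (by fun_prop) ?_
    refine continuous_parametric_integral_of_continuous ?_ (isCompact_closedBall 0 R)
    have := tent_continuous (N := N) (R := R)
    exact hΦc.comp (by fun_prop)
  have hJle : ∀ t, J (γ t) ≤ 1 / 2 * (T ^ 2 * I) := by
    intro t
    rw [hJγ]
    have h1 : 0 ≤ ∫ x in Metric.closedBall (0 : Space N) R, Φ ((t * T) * tent R x) :=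
      integral_nonneg fun x => hΦ0 _
    have h2 : ((t : ℝ) * T) ^ 2 ≤ T ^ 2 := by
      have := t.2.1
      gcongr
      exact mul_le_of_le_one_left hT0.le t.2.2
    have h3 : ((t : ℝ) * T) ^ 2 * I ≤ T ^ 2 * I := by gcongr
    linarith
  have hfin : J (γ 1) < 0 := by
    rw [hJγ]
    simp only [Set.Icc.coe_one, one_mul]
    have hi : IntegrableOn (fun x => Φ (T * tent R x)) (Metric.closedBall (0 : Space N) R) :=
      (hΦc.comp (continuous_const.mul tent_continuous)).continuousOn.integrableOn_compact
        (isCompact_closedBall 0 R)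
    have h1 : c * (T / 2) ^ θ * b ≤
        ∫ x in Metric.closedBall (0 : Space N) (R / 2), Φ (T * tent R x) := by
      have hsub : Metric.closedBall (0 : Space N) (R / 2) ⊆ Metric.closedBall 0 R :=
        Metric.closedBall_subset_closedBall (by linarith)
      calc c * (T / 2) ^ θ * b = ∫ _ in Metric.closedBall (0 : Space N) (R / 2), c * (T / 2) ^ θ := by
            rw [setIntegral_const, smul_eq_mul, mul_comm]
        _ ≤ _ := by
            refine setIntegral_mono_on (integrableOn_const measure_closedBall_lt_top.ne)
              (hi.mono_set hsub) measurableSet_closedBall fun x hx => ?_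
            rw [mem_closedBall_zero_iff] at hx
            have hx2 : 1 / 2 ≤ tent R x := by
              refine le_max_of_le_right ?_
              have : ‖x‖ / R ≤ 1 / 2 := by rw [div_le_iff₀ hR0]; linarith
              linarith
            have hx3 : T / 2 ≤ T * tent R x := by nlinarith
            calc c * (T / 2) ^ θ ≤ c * (T * tent R x) ^ θ := by gcongr
              _ ≤ primitive f (T * tent R x) := hF _ (by linarith)
              _ ≤ Φ (T * tent R x) := primitive_mono hf.continuous (fTrunc_continuous hf hpq)
                  (le_fTrunc hf hpq hl) (by linarith)
    have h2 : ∫ x in Metric.closedBall (0 : Space N) (R / 2), Φ (T * tent R x) ≤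
        ∫ x in Metric.closedBall (0 : Space N) R, Φ (T * tent R x) :=
      setIntegral_mono_set hi (Eventually.of_forall fun x => hΦ0 _)
        (Eventually.of_forall (Metric.closedBall_subset_closedBall (by linarith)))
    linarith
  have hadm : IsAdmissiblePath s K V J γ := by
    refine ⟨fun t => (tent_memE hK hV).const_mul _, fun t => ?_, ?_, hfin⟩
    · have h1 : ∀ r : unitInterval, normE K V (γ r - γ t) =
          |((r : ℝ) - t) * T| * normE K V (tent R) := by
        intro r
        rw [← normE_const_mul]
        congr 1
        funext x
        simp only [hγ, Pi.sub_apply]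
        ring
      simp only [h1]
      have h2 : Continuous fun r : unitInterval =>
          |((r : ℝ) - t) * T| * normE K V (tent R) := by fun_prop
      simpa using h2.tendsto t
    · exact Eventually.of_forall fun x => by simp [hγ]
  obtain ⟨t, -, ht⟩ := isCompact_univ.exists_isMaxOn Set.univ_nonempty hJc.continuousOn
  have hmem : J (γ t) ∈ {m : ℝ | ∃ γ : unitInterval → Space N → ℝ,
      IsAdmissiblePath s K V J γ ∧ IsGreatest (Set.range fun t => J (γ t)) m} := by
    refine ⟨γ, hadm, ⟨t, rfl⟩, ?_⟩
    rintro _ ⟨r, rfl⟩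
    exact ht (Set.mem_univ r)
  -- no lower bound for the levels is needed: the infimum of an unbounded set of reals is zero
  by_cases hbdd : BddBelow {m : ℝ | ∃ γ : unitInterval → Space N → ℝ,
      IsAdmissiblePath s K V J γ ∧ IsGreatest (Set.range fun t => J (γ t)) m}
  · exact (csInf_le hbdd hmem).trans (hJle t)
  · rw [minimaxLevel, Real.sInf_of_not_bddBelow hbdd]
    positivity

/-- Below the level `c₀` solutions are bounded in `E`, by the Ambrosetti–Rabinowitz condition. -/
theorem IsAuxSolution.innerE_le (hK : KernelAssumptions N s R K)
    (hV : PotentialAssumptions N s R Λ V) (hf : NonlinearityAssumptions N s p θ f)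
    (hpq : p < q) (hl : 0 < lam) {u : Space N → ℝ}
    (hu : IsAuxSolution s f K V p q θ R lam k u) {c₀ : ℝ} (hc₀ : 0 ≤ c₀)
    (hJ : energy f K V p q θ R lam k u ≤ c₀) :
    innerE K V u u ≤ 4 * θ / (θ - 2) * c₀ := by
  have hθ : 0 < θ - 2 := by linarith [hf.two_lt_θ]
  have hθ' : 0 < θ := by linarith
  have hw := hu.weak u hu.mem
  by_cases hi : Integrable fun x => gAux f V p q θ R lam k x (u x) * u x
  swap
  · -- the Bochner integral on the right of the weak formulation is then zero
    rw [hw, integral_undef hi]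
    positivity
  have hG : ∫ x, primitive (gAux f V p q θ R lam k x) (u x) ≤
      ∫ x, (1 / θ * (gAux f V p q θ R lam k x (u x) * u x) +
        (θ - 2) / (4 * θ) * (V x * u x ^ 2)) := by
    refine integral_mono_of_nonneg ?_
      ((hi.const_mul _).add (hu.mem.finite_potential.const_mul _)) ?_
    · filter_upwards [hV.nonneg] with x hx
      exact primitive_nonneg (fun t ht => gAux_of_nonpos hf hpq x ht) (gAux_nonneg hf hpq hl hx) _
    · filter_upwards [hV.nonneg] with x hx
      by_cases hxR : ‖x‖ ≤ R
      · have h1 := mul_primitive_fTrunc_le (k := k) hf hpq hl (u x)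
        have h2 : gAux f V p q θ R lam k x (u x) = fTrunc f p q lam k (u x) := by
          simp [gAux, hxR]
        have h3 : 0 ≤ (θ - 2) / (4 * θ) * (V x * u x ^ 2) := by positivity
        rw [primitive_gAux_inside x hxR, h2]
        have h4 : primitive (fTrunc f p q lam k) (u x) ≤
            1 / θ * (fTrunc f p q lam k (u x) * u x) := by
          rw [one_div, ← div_eq_inv_mul, le_div_iff₀ hθ']
          linarith
        linarith
      · have h1 := primitive_gAux_outside (k := k) hf hpq hl (not_le.1 hxR) hx (u x)
        have h2 : 0 ≤ gAux f V p q θ R lam k x (u x) * u x := by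
          rcases le_total (u x) 0 with h | h
          · rw [gAux_of_nonpos hf hpq x h, zero_mul]
          · exact mul_nonneg (gAux_nonneg hf hpq hl hx _) h
        have h3 : 0 ≤ 1 / θ * (gAux f V p q θ R lam k x (u x) * u x) := by positivity
        linarith
  rw [integral_add (hi.const_mul _) (hu.mem.finite_potential.const_mul _), integral_const_mul,
    integral_const_mul, ← hw] at hG
  rw [energy, normE_sq hK hV] at hJ
  have hP : ∫ x, V x * u x ^ 2 ≤ innerE K V u u := by
    rw [innerE_self_eq]
    linarith [form_self_nonneg hK u]
  have hP' : (θ - 2) / (4 * θ) * ∫ x, V x * u x ^ 2 ≤ (θ - 2) / (4 * θ) * innerE K V u u := by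
    gcongr
  have hfinal : (θ - 2) / (4 * θ) * innerE K V u u ≤ c₀ := by
    have e : (1 / 2 - 1 / θ - (θ - 2) / (4 * θ)) * innerE K V u u =
        (θ - 2) / (4 * θ) * innerE K V u u := by
      field_simp
      ring
    linarith
  rw [div_mul_eq_mul_div, div_le_iff₀ (by positivity)] at hfinal
  rw [div_mul_eq_mul_div, le_div_iff₀ hθ]
  linarith

end Minimax

/-! ### Sign and boundedness of solutions -/

section Bound

variable {N : ℕ} {s p q θ R Λ lam : ℝ} {f : ℝ → ℝ} {K V u : Space N → ℝ} {k : ℕ}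

theorem sq_sub_truncation_le (a b h : ℝ) :
    (max (a - h) 0 - max (b - h) 0) ^ 2 ≤ (a - b) * (max (a - h) 0 - max (b - h) 0) := by
  rcases max_cases (a - h) 0 with h₁ | h₁ <;> rcases max_cases (b - h) 0 with h₂ | h₂ <;>
    rw [h₁.1, h₂.1] <;> nlinarith

theorem MemE.truncation (hK : KernelAssumptions N s R K) (hV : PotentialAssumptions N s R Λ V)
    (hu : MemE s K V u) {h : ℝ} (hh : 0 ≤ h) : MemE s K V fun x => max (u x - h) 0 := by
  refine hu.comp_lipschitz hK hV (φ := fun t => max (t - h) 0) (fun a b => ?_)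
    (max_eq_right (by linarith))
  calc |max (a - h) 0 - max (b - h) 0| ≤ |a - h - (b - h)| := abs_max_sub_max_le_abs _ _ _
    _ = |a - b| := by ring_nf

/-- Solutions are nonnegative, by testing with the negative part. -/
theorem IsAuxSolution.ae_nonneg (hs0 : 0 < s) (hN : 2 * s < N) (hK : KernelAssumptions N s R K)
    (hV : PotentialAssumptions N s R Λ V) (hf : NonlinearityAssumptions N s p θ f)
    (hpq : p < q) (hu : IsAuxSolution s f K V p q θ R lam k u) :
    ∀ᵐ x, 0 ≤ u x := by
  have hu' := hu.mem.const_mul (-1)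
  set v : Space N → ℝ := fun x => max (-1 * u x - 0) 0 with hv
  have hvE : MemE s K V v := hu'.truncation hK hV le_rfl
  have hw := hu.weak v hvE
  have h1 : ∫ x, gAux f V p q θ R lam k x (u x) * v x = 0 := by
    rw [← integral_zero (Space N) ℝ (μ := volume)]
    congr 1
    funext x
    rcases le_total (u x) 0 with h | h
    · rw [gAux_of_nonpos hf hpq x h, zero_mul]
    · have : v x = 0 := max_eq_right (by linarith)
      rw [this, mul_zero]
  have h2 : ∫ x, V x * u x * v x = -∫ x, V x * v x ^ 2 := by
    rw [← integral_neg]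
    congr 1
    funext x
    rcases le_total (u x) 0 with h | h
    · have : v x = -u x := (max_eq_left (by linarith)).trans (by ring)
      rw [this]; ring
    · have : v x = 0 := max_eq_right (by linarith)
      rw [this]; ring
  have h3 : form K v v ≤ form K (fun x => -1 * u x) v := by
    exact form_self_le_form hK hvE.finite_form (FiniteEnergy.integrable_form hK
      hu'.aestronglyMeasurable hvE.aestronglyMeasurable hu'.finite_form hvE.finite_form)
      (Eventually.of_forall fun z => sq_sub_truncation_le _ _ _)
  have h4 : form K (fun x => -1 * u x) v = -form K u v := by
    rw [form, form, ← integral_neg]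
    congr 1
    funext z
    ring
  have h5 : form K v v ≤ 0 := by
    have := integral_potential_nonneg hV v
    rw [innerE, h1, h2] at hw
    linarith
  have h6 := ae_eq_zero_of_form_nonpos hs0 hN hK (hvE.integrable_rpow hs0 hN) hvE.finite_form h5
  filter_upwards [h6] with x hx
  have h7 : max (-1 * u x - 0) 0 = 0 := hx
  have h8 := le_max_left (-1 * u x - 0) 0
  linarith

/-- The reverse inequality behind the iteration, from testing with `(u - h)⁺` and
`g_{λ,k}(x,t) ≤ f_{λ,k}(t) ≤ C (1 + λ k^(q-p)) t^(p-1)`. -/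
theorem IsAuxSolution.truncation_estimate (hs0 : 0 < s) (hN : 2 * s < N)
    (hK : KernelAssumptions N s R K)
    (hV : PotentialAssumptions N s R Λ V) (hf : NonlinearityAssumptions N s p θ f)
    (hpq : p < q) (hl : 0 < lam) {C : ℝ} (hC1 : 1 ≤ C)
    (hC : ∀ t, 0 ≤ t → f t ≤ C * t ^ (p - 1))
    (hu : IsAuxSolution s f K V p q θ R lam k u) {h : ℝ} (hh : 0 < h) :
    form K (fun x => max (u x - h) 0) (fun x => max (u x - h) 0) ≤
      C * (1 + lam * (k : ℝ) ^ (q - p)) * ∫ x, u x ^ (p - 1) * max (u x - h) 0 := by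
  have hp := hf.two_lt_p
  have hpr := hf.p_lt
  have hu0 := hu.ae_nonneg hs0 hN hK hV hf hpq
  set v : Space N → ℝ := fun x => max (u x - h) 0 with hv
  have hvE : MemE s K V v := hu.mem.truncation hK hV hh.le
  have hw := hu.weak v hvE
  have h1 : form K v v ≤ form K u v := by
    exact form_self_le_form hK hvE.finite_form (FiniteEnergy.integrable_form hK
      hu.mem.aestronglyMeasurable hvE.aestronglyMeasurable hu.mem.finite_form hvE.finite_form)
      (Eventually.of_forall fun z => sq_sub_truncation_le _ _ _)
  have h2 : 0 ≤ ∫ x, V x * u x * v x := by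
    refine integral_nonneg_of_ae ?_
    filter_upwards [hu0, hV.nonneg] with x hx hVx
    exact mul_nonneg (mul_nonneg hVx hx) (le_max_right _ _)
  have hint : Integrable fun x => u x ^ (p - 1) * v x := by
    have hm : AEStronglyMeasurable fun x => u x ^ (p - 1) * v x :=
      (hu.mem.aestronglyMeasurable.aemeasurable.pow_const (p - 1)).aestronglyMeasurable.mul
        hvE.aestronglyMeasurable
    refine ((hu.mem.integrable_rpow hs0 hN).const_mul (h ^ (p - critExp N s))).mono' hm ?_
    filter_upwards [hu0] with x hx
    have hvx : 0 ≤ v x := le_max_right _ _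
    rw [Real.norm_of_nonneg (by positivity), abs_of_nonneg hx]
    rcases le_or_gt (u x) h with hxh | hxh
    · have : v x = 0 := max_eq_right (by linarith)
      rw [this, mul_zero]
      positivity
    · have hpos : 0 < u x := hh.trans hxh
      calc u x ^ (p - 1) * v x ≤ u x ^ (p - 1) * u x := by
            gcongr
            exact max_le (by linarith) hx
        _ = u x ^ (p - critExp N s) * u x ^ critExp N s := by
            rw [← Real.rpow_add_one hpos.ne', ← Real.rpow_add hpos]; ring_nf
        _ ≤ h ^ (p - critExp N s) * u x ^ critExp N s := by
            gcongr ?_ * _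
            exact Real.rpow_le_rpow_of_nonpos hh hxh.le (by linarith)
  have h3 : ∫ x, gAux f V p q θ R lam k x (u x) * v x ≤
      ∫ x, C * (1 + lam * (k : ℝ) ^ (q - p)) * (u x ^ (p - 1) * v x) := by
    refine integral_mono_of_nonneg ?_ (hint.const_mul _) ?_
    · filter_upwards [hV.nonneg] with x hVx
      exact mul_nonneg (gAux_nonneg hf hpq hl hVx _) (le_max_right _ _)
    · filter_upwards [hu0] with x hx
      rw [← mul_assoc]
      exact mul_le_mul_of_nonneg_right ((gAux_le_fTrunc hf x hx).trans
        (fTrunc_le hf hpq hl hC1 hC hx)) (le_max_right _ _)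
  rw [integral_const_mul] at h3
  rw [innerE] at hw
  linarith

/-- Solutions of energy at most `c₀` are bounded by a multiple of `(1 + λ k^(q-p))^(1/(2^*_s-p))`,
the constant depending on `c₀` only. -/
theorem exists_forall_ae_le (hs0 : 0 < s) (hN : 2 * s < N) (hK : KernelAssumptions N s R K)
    (hV : PotentialAssumptions N s R Λ V) (hf : NonlinearityAssumptions N s p θ f)
    (hpq : p < q) {c₀ : ℝ} (hc₀ : 0 ≤ c₀) :
    ∃ C : ℝ, 0 < C ∧ ∀ lam : ℝ, 0 < lam → ∀ (k : ℕ) (u : Space N → ℝ),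
      IsAuxSolution s f K V p q θ R lam k u → energy f K V p q θ R lam k u ≤ c₀ →
      ∀ᵐ x, u x ≤ C * (1 + lam * (k : ℝ) ^ (q - p)) ^ (1 / (critExp N s - p)) := by
  have hp := hf.two_lt_p
  have hpr := hf.p_lt
  have hr := two_lt_critExp hs0 hN
  have hθ : 0 < θ - 2 := by linarith [hf.two_lt_θ]
  obtain ⟨S, hS, hsob⟩ := sobolev hs0 hN hK
  obtain ⟨Cf, hCf1, hCf⟩ := hf.growth
  set r := critExp N s with hrdef
  set U := (S * (4 * θ / (θ - 2) * c₀)) ^ (r / 2) + 1 with hU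
  have hU0 : 0 < U := by
    have : 0 < θ := by linarith
    positivity
  set τ : ℝ := (2 ^ r : ℝ) ^ (-((r / 2) / (r / 2 - 1))) with hτ
  have hτ0 : 0 < τ := by positivity
  -- chosen so that the smallness condition of the iteration holds with equality
  set L : ℝ := (U ^ (r / 2 - 1) / τ) ^ (2 / r) with hL
  have hL0 : 0 < L := by positivity
  have hLr : L ^ (r / 2) = U ^ (r / 2 - 1) / τ := by
    rw [hL, ← Real.rpow_mul (by positivity), show 2 / r * (r / 2) = 1 by field_simp, Real.rpow_one]
  have hCf0 : 0 < Cf := by linarith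
  refine ⟨2 * (4 ^ r * S * Cf * L) ^ (1 / (r - p)), by positivity, fun lam hl k u hu hJ => ?_⟩
  set a := 1 + lam * (k : ℝ) ^ (q - p) with ha
  have ha0 : 0 < a := by positivity
  set M := (4 ^ r * S * Cf * L) ^ (1 / (r - p)) * a ^ (1 / (r - p)) with hM
  have hM0 : 0 < M := by positivity
  have hrp : r - p ≠ 0 := by linarith
  have hMr : M ^ (p - r) = (4 ^ r * S * Cf * L * a)⁻¹ := by
    rw [hM, ← Real.mul_rpow (by positivity) (by positivity), ← Real.rpow_mul (by positivity),
      show 1 / (r - p) * (p - r) = -1 by field_simp; ring, Real.rpow_neg_one]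
  have hu0 := hu.ae_nonneg hs0 hN hK hV hf hpq
  have hui := hu.mem.integrable_rpow hs0 hN
  have hform : form K u u ≤ 4 * θ / (θ - 2) * c₀ := by
    have h1 := hu.innerE_le hK hV hf hpq hl hc₀ hJ
    rw [innerE_self_eq] at h1
    linarith [integral_potential_nonneg hV u]
  have huU : ∫ x, |u x| ^ r ≤ U := by
    refine (hsob u hui hu.mem.finite_form).trans ?_
    have h0 := form_self_nonneg hK u
    have : (S * form K u u) ^ (r / 2) ≤ (S * (4 * θ / (θ - 2) * c₀)) ^ (r / 2) := by gcongr
    linarith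
  have key := ae_le_of_truncation_estimate (p := p) (r := r) (M := M) (B := S * (Cf * a)) (U := U)
    hu.mem.aestronglyMeasurable hu0 hui (by linarith) hpr hr hM0 (by positivity) hU0 huU ?_ ?_
  · filter_upwards [key] with x hx
    rw [mul_assoc]
    exact hx
  · intro h hh
    have hh0 : 0 < h := hM0.trans_le hh
    have hvE := hu.mem.truncation hK hV hh0.le
    have h1 := hsob _ (hvE.integrable_rpow hs0 hN) hvE.finite_form
    have h2 := hu.truncation_estimate hs0 hN hK hV hf hpq hl hCf1 hCf hh0
    have h3 : ∀ x, |max (u x - h) 0| = max (u x - h) 0 := fun x => abs_of_nonneg (le_max_right _ _)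
    simp only [h3] at h1
    refine h1.trans ?_
    have h0 := form_self_nonneg hK fun x => max (u x - h) 0
    rw [mul_assoc S]
    gcongr
  · have e : 4 ^ r * (S * (Cf * a)) * M ^ (p - r) = L⁻¹ := by
      rw [hMr]
      field_simp
    rw [e, Real.inv_rpow hL0.le, hLr, inv_div, div_mul_cancel₀ _ (by positivity)]

end Bound

/-! ### The supersolution against non-smooth test functions -/

section Supersolution

variable {N : ℕ} {s R : ℝ} {K w v : Space N → ℝ} {C : ℝ}

theorem HasBoundedIncrements.comp_add_right (hw : HasBoundedIncrements C w) (h : Space N) :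
    HasBoundedIncrements C fun x => w (x + h) := fun x y => by
  simpa using hw (x + h) (y + h)

theorem integrable_increments_bound (hK : KernelAssumptions N s R K) (hvE : FiniteEnergy K v)
    {S : Set (Space N)} (hS : MeasurableSet S) (hS' : volume S ≠ ⊤) (a b : ℝ) :
    Integrable fun z : Space N × Space N =>
      (a * localWeight S z + b * (v z.1 - v z.2) ^ 2) * K (z.1 - z.2) := by
  refine (((integrable_localWeight hK hS hS').const_mul a).add (hvE.const_mul b)).congr
    (Eventually.of_forall fun z => ?_)
  simp only [Pi.add_apply]
  ring

theorem norm_form_integrand_le (hw : HasBoundedIncrements C w) (hC : 0 ≤ C) {S : Set (Space N)}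
    (hvS : ∀ x, x ∉ S → v x = 0) {z : Space N × Space N} (hz : 0 ≤ K (z.1 - z.2)) :
    ‖(w z.1 - w z.2) * (v z.1 - v z.2) * K (z.1 - z.2)‖ ≤
      (C * localWeight S z + 1 * (v z.1 - v z.2) ^ 2) * K (z.1 - z.2) := by
  rw [Real.norm_eq_abs, abs_mul, abs_of_nonneg hz, one_mul]
  gcongr
  exact abs_mul_le_localWeight hw hC (hvS _) (hvS _)

theorem continuous_form_translate (hK : KernelAssumptions N s R K)
    (hw : HasBoundedIncrements C w) (hC : 0 ≤ C) (hwc : Continuous w)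
    (hvm : AEStronglyMeasurable v) (hvE : FiniteEnergy K v)
    {S : Set (Space N)} (hS : MeasurableSet S) (hS' : volume S ≠ ⊤) (hvS : ∀ x, x ∉ S → v x = 0) :
    Continuous fun h => form K (fun x => w (x + h)) v := by
  unfold form
  refine continuous_of_dominated (fun h => ?_) (fun h => ?_)
    (integrable_increments_bound hK hvE hS hS' C 1) (Eventually.of_forall fun z => ?_)
  · exact ((aestronglyMeasurable_diff
      (hwc.comp (continuous_add_const h)).aestronglyMeasurable).mul
      (aestronglyMeasurable_diff hvm)).mul hK.measurable_diff.aestronglyMeasurable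
  · filter_upwards [hK.ae_nonneg_prod] with z hz
    exact norm_form_integrand_le (hw.comp_add_right h) hC hvS hz
  · fun_prop

/-- Mollification of the second argument averages the form over translates of the first. -/
theorem form_convolution (hK : KernelAssumptions N s R K)
    (hw : HasBoundedIncrements C w) (hC : 0 ≤ C) (hwc : Continuous w)
    (hvm : AEStronglyMeasurable v) (hvE : FiniteEnergy K v) (hvi : Integrable v)
    {S : Set (Space N)} (hS : MeasurableSet S) (hS' : volume S ≠ ⊤) (hvS : ∀ x, x ∉ S → v x = 0)
    {ρ : Space N → ℝ} (hρc : Continuous ρ) (hρs : HasCompactSupport ρ) :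
    form K w (convolution ρ v (ContinuousLinearMap.lsmul ℝ ℝ) volume) =
      ∫ h, ρ h * form K (fun x => w (x + h)) v := by
  have hinv : (volume : Measure (Space N × Space N)).IsAddRightInvariant :=
    inferInstanceAs ((volume : Measure (Space N)).prod volume).IsAddRightInvariant
  set J : Space N → Space N × Space N → ℝ := fun h z =>
    ρ h * ((w (z.1 + h) - w (z.2 + h)) * (v z.1 - v z.2) * K (z.1 - z.2)) with hJ
  have hρi : Integrable ρ := hρc.integrable_of_hasCompactSupport hρs
  have hJi : Integrable (Function.uncurry J) (volume.prod volume) := by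
    have hb := hρi.norm.mul_prod (integrable_increments_bound hK hvE hS hS' C 1)
    refine hb.mono' ?_ ?_
    · have h1 : Continuous fun a : Space N × (Space N × Space N) =>
          w (a.2.1 + a.1) - w (a.2.2 + a.1) := by fun_prop
      have h2 : AEStronglyMeasurable (fun a : Space N × (Space N × Space N) =>
          (v a.2.1 - v a.2.2) * K (a.2.1 - a.2.2)) (volume.prod volume) :=
        ((aestronglyMeasurable_diff hvm).mul
          hK.measurable_diff.aestronglyMeasurable).comp_snd
      refine ((hρc.comp continuous_fst).aestronglyMeasurable.mul
        (h1.aestronglyMeasurable.mul h2)).congr (Eventually.of_forall fun a => ?_)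
      simp only [Function.uncurry, hJ, Pi.mul_apply, Function.comp_apply]
      ring
    · have q : Measure.QuasiMeasurePreserving
          (Prod.snd : Space N × (Space N × Space N) → Space N × Space N)
          (volume.prod volume) volume := Measure.quasiMeasurePreserving_snd
      filter_upwards [q.ae hK.ae_nonneg_prod] with a ha
      simp only [Function.uncurry, hJ, norm_mul (ρ a.1)]
      exact mul_le_mul_of_nonneg_left
        (norm_form_integrand_le (hw.comp_add_right a.1) hC hvS ha) (norm_nonneg _)
  have hT : MeasurePreserving (fun a : Space N × (Space N × Space N) =>
      (a.1, a.2 - (a.1, a.1))) (volume.prod volume) (volume.prod volume) :=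
    (MeasurePreserving.id volume).skew_product (g := fun h z => z - (h, h)) (by fun_prop)
      (Eventually.of_forall fun h => (measurePreserving_sub_right volume ((h, h) :
        Space N × Space N)).map_eq)
  have hI : Integrable (Function.uncurry fun h (z : Space N × Space N) => J h (z - (h, h)))
      (volume.prod volume) := hT.integrable_comp_of_integrable hJi
  have hconv : ∀ x, Integrable fun h => ρ h * v (x - h) := fun x =>
    (hρs.convolutionExists_left (L := ContinuousLinearMap.lsmul ℝ ℝ) (f := ρ) (g := v) hρc
      hvi.locallyIntegrable x)
  calc form K w (convolution ρ v (ContinuousLinearMap.lsmul ℝ ℝ) volume)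
      = ∫ z : Space N × Space N, ∫ h, J h (z - (h, h)) := by
        unfold form
        congr 1
        funext z
        have e : (convolution ρ v (ContinuousLinearMap.lsmul ℝ ℝ) volume) z.1 -
            (convolution ρ v (ContinuousLinearMap.lsmul ℝ ℝ) volume) z.2 =
            ∫ h, (ρ h * v (z.1 - h) - ρ h * v (z.2 - h)) :=
          (integral_sub (hconv z.1) (hconv z.2)).symm
        rw [e, ← integral_const_mul, ← integral_mul_const]
        congr 1
        funext h
        simp only [hJ, Prod.fst_sub, Prod.snd_sub, sub_add_cancel, sub_sub_sub_cancel_right]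
        ring
    _ = ∫ h, ∫ z : Space N × Space N, J h (z - (h, h)) :=
        (integral_integral_swap hI).symm
    _ = ∫ h, ρ h * form K (fun x => w (x + h)) v := by
        congr 1
        funext h
        rw [integral_sub_right_eq_self (fun z => J h z) ((h, h) : Space N × Space N), form,
          ← integral_const_mul]

/-- `Γ_*` is a supersolution also when tested with compactly supported functions of finite energy
vanishing near the ball of radius `R`. -/
theorem KernelAssumptions.form_gammaStar_nonneg_of_compactSupport (hN : 2 * s < N) (hR : 1 < R)
    (hK : KernelAssumptions N s R K) (hvm : AEStronglyMeasurable v) (hvE : FiniteEnergy K v)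
    (hvi : Integrable v) (hv0 : ∀ x, 0 ≤ v x) (hvs : HasCompactSupport v) {d : ℝ} (hd : 0 < d)
    (hvd : ∀ x, ‖x‖ < R + d → v x = 0) : 0 ≤ form K (gammaStar N s R) v := by
  obtain ⟨C, hC, hw⟩ := gammaStar_increments hN hR
  have hwc : Continuous (gammaStar N s R : Space N → ℝ) := gammaStar_continuous hR
  have hS : MeasurableSet (tsupport v) := (isClosed_tsupport v).measurableSet
  have hS' : volume (tsupport v) ≠ ⊤ := hvs.isCompact.measure_lt_top.ne
  have hvS : ∀ x, x ∉ tsupport v → v x = 0 := fun x => image_eq_zero_of_notMem_tsupport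
  have hcont := continuous_form_translate hK hw hC hwc hvm hvE hS hS' hvS
  set Φ : Space N → ℝ := fun h => form K (fun x => gammaStar N s R (x + h)) v with hΦ
  have hΦ0 : Φ 0 = form K (gammaStar N s R) v := by simp [hΦ]
  rw [← hΦ0]
  by_contra! hneg
  obtain ⟨ε, hε, hball⟩ := Metric.eventually_nhds_iff_ball.1
    (hcont.continuousAt.eventually_lt (continuousAt_const (y := Φ 0 / 2))
      (by linarith : Φ 0 < Φ 0 / 2))
  set r := min ε (d / 2) with hr
  have hr0 : 0 < r := by positivity
  let φ : ContDiffBump (0 : Space N) := ⟨r / 2, r, by positivity, by linarith⟩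
  have hφr : φ.rOut = r := rfl
  set ρ := φ.normed volume with hρ
  have hρc : Continuous ρ := φ.continuous_normed
  have hρs : HasCompactSupport ρ := φ.hasCompactSupport_normed
  have hρ0 : ∀ h, 0 ≤ ρ h := fun h => φ.nonneg_normed h
  have hρz : ∀ h, h ∉ Metric.ball (0 : Space N) r → ρ h = 0 := fun h hh => by
    rw [← Function.notMem_support, hρ, φ.support_normed_eq, hφr]
    exact hh
  have hform := form_convolution hK hw hC hwc hvm hvE hvi hS hS' hvS hρc hρs
  have hpos : 0 ≤ form K (gammaStar N s R)
      (convolution ρ v (ContinuousLinearMap.lsmul ℝ ℝ) volume) := by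
    refine hK.supersolution _ ?_ ?_ ?_ fun x => ?_
    · exact hρs.contDiff_convolution_left _ φ.contDiff_normed hvi.locallyIntegrable
    · exact HasCompactSupport.convolution _ hρs hvs
    · have hsub : Function.support (convolution ρ v (ContinuousLinearMap.lsmul ℝ ℝ) volume) ⊆
          {x | R + d / 2 ≤ ‖x‖} := by
        refine (support_convolution_subset _).trans ?_
        rintro _ ⟨h, hh, y, hy, rfl⟩
        have h1 : ‖h‖ < r := by
          by_contra hc
          exact hh (hρz h (by simpa using hc))
        have h2 : R + d ≤ ‖y‖ := by
          by_contra! hc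
          exact hy (hvd y hc)
        have h3 : r ≤ d / 2 := min_le_right _ _
        have h4 := norm_sub_le (h + y) h
        rw [add_sub_cancel_left] at h4
        show R + d / 2 ≤ ‖h + y‖
        linarith
      refine (closure_minimal hsub (isClosed_le continuous_const continuous_norm)).trans
        fun x hx => ?_
      have hx' : R + d / 2 ≤ ‖x‖ := hx
      rw [Set.mem_compl_iff, mem_closedBall_zero_iff]
      linarith
    · exact integral_nonneg fun h => mul_nonneg (hρ0 h) (hv0 _)
  rw [hform] at hpos
  have hle : ∫ h, ρ h * Φ h ≤ ∫ h, ρ h * (Φ 0 / 2) := by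
    refine integral_mono ?_ ((hρc.integrable_of_hasCompactSupport hρs).mul_const _) fun h => ?_
    · exact (hρc.mul hcont).integrable_of_hasCompactSupport hρs.mul_right
    · by_cases hh : h ∈ Metric.ball (0 : Space N) r
      · exact mul_le_mul_of_nonneg_left
          (hball h (Metric.ball_subset_ball (min_le_left _ _) hh)).le (hρ0 h)
      · simp [hρz h hh]
  rw [integral_mul_const, φ.integral_normed, one_mul] at hle
  linarith

/-- `Γ_*` is a supersolution also when tested with bounded functions of finite energy and
finite-measure support vanishing near the ball of radius `R`. -/
theorem KernelAssumptions.form_gammaStar_nonneg (hN : 2 * s < N) (hR : 1 < R)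
    (hK : KernelAssumptions N s R K) (hvm : AEStronglyMeasurable v) (hvE : FiniteEnergy K v)
    (hv0 : ∀ x, 0 ≤ v x) {B : ℝ} (hvB : ∀ x, v x ≤ B) {S : Set (Space N)} (hS : MeasurableSet S)
    (hS' : volume S ≠ ⊤) (hvS : ∀ x, x ∉ S → v x = 0) {d : ℝ} (hd : 0 < d)
    (hvd : ∀ x, ‖x‖ < R + d → v x = 0) : 0 ≤ form K (gammaStar N s R) v := by
  obtain ⟨C, hC, hw⟩ := gammaStar_increments hN hR
  have hwc : Continuous (gammaStar N s R : Space N → ℝ) := gammaStar_continuous hR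
  set η : ℕ → Space N → ℝ := fun n => tent ((n : ℝ) + 2) with hη
  have hn : ∀ n : ℕ, (1 : ℝ) < n + 2 := fun n => by
    have : (0 : ℝ) ≤ n := n.cast_nonneg
    linarith
  have hη1 : ∀ n x, η n x ≤ 1 := fun n x => by
    have h1 : 0 ≤ ‖x‖ / ((n : ℝ) + 2) := by positivity
    exact max_le zero_le_one (by linarith)
  have hη0 : ∀ n x, 0 ≤ η n x := fun n x => tent_nonneg x
  have hηlim : ∀ x, Tendsto (fun n => η n x) atTop (𝓝 1) := fun x => by
    have h1 : Tendsto (fun n : ℕ => ‖x‖ / ((n : ℝ) + 2)) atTop (𝓝 0) :=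
      tendsto_const_nhds.div_atTop
        (tendsto_atTop_add_const_right _ _ tendsto_natCast_atTop_atTop)
    have h2 := (tendsto_const_nhds (x := (0 : ℝ))).max ((tendsto_const_nhds (x := (1 : ℝ))).sub h1)
    simpa [hη, tent] using h2
  set vn : ℕ → Space N → ℝ := fun n x => η n x * v x with hvn
  have hvnm : ∀ n, AEStronglyMeasurable (vn n) := fun n =>
    tent_continuous.aestronglyMeasurable.mul hvm
  have hvnS : ∀ n x, x ∉ S → vn n x = 0 := fun n x hx => by simp [hvn, hvS x hx]
  have hbound : ∀ n (z : Space N × Space N), (vn n z.1 - vn n z.2) ^ 2 ≤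
      4 * B ^ 2 * localWeight S z + 2 * (v z.1 - v z.2) ^ 2 := by
    intro n z
    have hW := localWeight_nonneg S z
    have h1 : (v z.2) ^ 2 * (η n z.1 - η n z.2) ^ 2 ≤ 2 * B ^ 2 * localWeight S z := by
      by_cases hz : z.2 ∈ S
      · have h2 := tent_increments (hn n) z.1 z.2
        have h3 := min_le_localWeight (S := S) (z := z) (Or.inr hz)
        have h4 : (η n z.1 - η n z.2) ^ 2 ≤ 2 * localWeight S z := by
          refine h2.trans ?_
          norm_num
          simpa using h3
        calc (v z.2) ^ 2 * (η n z.1 - η n z.2) ^ 2 ≤ B ^ 2 * (2 * localWeight S z) := by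
              have := hv0 z.2
              have := hvB z.2
              gcongr
          _ = _ := by ring
      · rw [hvS _ hz]
        simp only [ne_eq, OfNat.ofNat_ne_zero, not_false_eq_true, zero_pow, zero_mul]
        positivity
    have h5 : (η n z.1 * (v z.1 - v z.2)) ^ 2 ≤ (v z.1 - v z.2) ^ 2 := by
      rw [mul_pow]
      exact mul_le_of_le_one_left (sq_nonneg _) (pow_le_one₀ (hη0 n z.1) (hη1 n z.1))
    have e : vn n z.1 - vn n z.2 =
        η n z.1 * (v z.1 - v z.2) + v z.2 * (η n z.1 - η n z.2) := by
      simp only [hvn]; ring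
    rw [e]
    nlinarith [sq_nonneg (η n z.1 * (v z.1 - v z.2) - v z.2 * (η n z.1 - η n z.2))]
  have hvi : Integrable v := by
    have h1 : Integrable (S.indicator fun _ : Space N => B) :=
      (integrable_indicator_iff hS).2 (integrableOn_const hS')
    refine h1.mono' hvm (Eventually.of_forall fun x => ?_)
    rw [Real.norm_of_nonneg (hv0 x)]
    by_cases hx : x ∈ S
    · simpa [hx] using hvB x
    · simp [hx, hvS x hx]
  have hpos : ∀ n, 0 ≤ form K (gammaStar N s R) (vn n) := by
    intro n
    refine hK.form_gammaStar_nonneg_of_compactSupport hN hR (hvnm n)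
      (FiniteEnergy.of_sq_le hK (hvnm n) (integrable_increments_bound hK hvE hS hS' _ _)
        (Eventually.of_forall (hbound n))) ?_ (fun x => mul_nonneg (hη0 n x) (hv0 x)) ?_ hd
      fun x hx => by simp [hvn, hvd x hx]
    · refine hvi.mono' (hvnm n) (Eventually.of_forall fun x => ?_)
      rw [Real.norm_of_nonneg (mul_nonneg (hη0 n x) (hv0 x))]
      exact mul_le_of_le_one_left (hv0 x) (hη1 n x)
    · refine HasCompactSupport.intro (isCompact_closedBall 0 ((n : ℝ) + 2)) fun x hx => ?_
      have : η n x = 0 := tent_eq_zero_of_notMem (by linarith [hn n]) hx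
      simp [hvn, this]
  have hlim : Tendsto (fun n => form K (gammaStar N s R) (vn n)) atTop
      (𝓝 (form K (gammaStar N s R) v)) := by
    unfold form
    refine tendsto_integral_of_dominated_convergence
      (fun z => ((C + 4 * B ^ 2) * localWeight S z + 2 * (v z.1 - v z.2) ^ 2) * K (z.1 - z.2))
      (fun n => ?_) (integrable_increments_bound hK hvE hS hS' _ _) (fun n => ?_)
      (Eventually.of_forall fun z => ?_)
    · exact ((aestronglyMeasurable_diff hwc.aestronglyMeasurable).mul
        (aestronglyMeasurable_diff (hvnm n))).mul hK.measurable_diff.aestronglyMeasurable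
    · filter_upwards [hK.ae_nonneg_prod] with z hz
      refine (norm_form_integrand_le hw hC (hvnS n) hz).trans ?_
      refine mul_le_mul_of_nonneg_right ?_ hz
      linarith [hbound n z]
    · have h1 : ∀ x, Tendsto (fun n => vn n x) atTop (𝓝 (v x)) := fun x => by
        simpa [hvn] using (hηlim x).mul_const (v x)
      exact (((h1 z.1).sub (h1 z.2)).const_mul _).mul_const _
  exact ge_of_tendsto' hlim hpos

end Supersolution

/-! ### Comparison with the supersolution -/

section Comparison

variable {N : ℕ} {s p q θ R Λ lam : ℝ} {f : ℝ → ℝ} {K V u : Space N → ℝ} {k : ℕ}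

theorem FiniteEnergy.congr {v v' : Space N → ℝ} (hv : FiniteEnergy K v)
    (h : v =ᵐ[volume] v') : FiniteEnergy K v' := by
  have q₁ : Measure.QuasiMeasurePreserving (Prod.fst : Space N × Space N → Space N) :=
    Measure.quasiMeasurePreserving_fst
  have q₂ : Measure.QuasiMeasurePreserving (Prod.snd : Space N × Space N → Space N) :=
    Measure.quasiMeasurePreserving_snd
  refine Integrable.congr hv ?_
  filter_upwards [q₁.ae h, q₂.ae h] with z h1 h2
  rw [h1, h2]

theorem form_const_mul_left (c : ℝ) (v w : Space N → ℝ) :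
    form K (fun x => c * w x) v = c * form K w v := by
  rw [form, form, ← integral_const_mul]
  congr 1
  funext z
  ring

/-- The multiple `M R^(N-2s) Γ_*` equals `M` on the ball of radius `R`, hence stays above `M - δ` on a
slightly larger one. -/
theorem exists_lt_mul_gammaStar (hR : 1 < R) (M : ℝ) {δ : ℝ} (hδ : 0 < δ) :
    ∃ d : ℝ, 0 < d ∧ ∀ x : Space N, ‖x‖ < R + d →
      M - δ < M * R ^ ((N : ℝ) - 2 * s) * gammaStar N s R x := by
  have hR0 : 0 < R := by linarith
  set e := (N : ℝ) - 2 * s with he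
  have hval : M * R ^ e * R ^ (-e) = M := by
    rw [mul_assoc, ← Real.rpow_add hR0, add_neg_cancel, Real.rpow_zero, mul_one]
  have hc : ContinuousAt (fun t : ℝ => M * R ^ e * t ^ (-e)) R :=
    continuousAt_const.mul (Real.continuousAt_rpow_const _ _ (Or.inl hR0.ne'))
  obtain ⟨d, hd, h⟩ := Metric.eventually_nhds_iff.1
    (continuousAt_const.eventually_lt hc (by rw [hval]; linarith : M - δ < M * R ^ e * R ^ (-e)))
  refine ⟨d, hd, fun x hx => ?_⟩
  refine h (y := max ‖x‖ R) ?_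
  rw [Real.dist_eq, abs_of_nonneg (sub_nonneg.2 (le_max_right _ _)), sub_lt_iff_lt_add']
  exact max_lt hx (by linarith)

/-- A solution bounded by `M` lies below the multiple of `Γ_*` that dominates it on the ball of
radius `R`. -/
theorem IsAuxSolution.ae_le_gammaStar (hs0 : 0 < s) (hN : 2 * s < N)
    (hK : KernelAssumptions N s R K) (hV : PotentialAssumptions N s R Λ V)
    (hf : NonlinearityAssumptions N s p θ f) (hpq : p < q) (hl : 0 < lam)
    (hu : IsAuxSolution s f K V p q θ R lam k u) {M : ℝ} (hM : 0 ≤ M) (huM : ∀ᵐ x, u x ≤ M) :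
    ∀ᵐ x, u x ≤ M * R ^ ((N : ℝ) - 2 * s) * gammaStar N s R x := by
  have hR := hV.one_lt_R
  have hR0 : 0 < R := by linarith
  have hθ : 0 < θ - 2 := by linarith [hf.two_lt_θ]
  have hr := two_lt_critExp hs0 hN
  have hu0 := hu.ae_nonneg hs0 hN hK hV hf hpq
  have hum := hu.mem.aestronglyMeasurable
  set c := M * R ^ ((N : ℝ) - 2 * s) with hc
  have hc0 : 0 ≤ c := by positivity
  obtain ⟨C, hC, hΓ⟩ := gammaStar_increments (N := N) hN hR
  have hΓc : Continuous (gammaStar N s R : Space N → ℝ) := gammaStar_continuous hR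
  have hΓ0 : ∀ x : Space N, 0 ≤ c * gammaStar N s R x := fun x =>
    mul_nonneg hc0 (gammaStar_nonneg x hR)
  have hw : HasBoundedIncrements (c ^ 2 * C) fun x : Space N => c * gammaStar N s R x := by
    intro x y
    rw [← mul_sub, mul_pow, mul_assoc]
    exact mul_le_mul_of_nonneg_left (hΓ x y) (sq_nonneg c)
  have hwm : AEStronglyMeasurable fun x : Space N => c * gammaStar N s R x :=
    (continuous_const.mul hΓc).aestronglyMeasurable
  -- it suffices to compare up to an additive constant, which keeps the test function away from
  -- the ball and gives it a support of finite measure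
  suffices hδ : ∀ n : ℕ, ∀ᵐ x, u x ≤ c * gammaStar N s R x + 1 / ((n : ℝ) + 1) by
    filter_upwards [ae_all_iff.2 hδ] with x hx
    have hlim := (tendsto_one_div_add_atTop_nhds_zero_nat (𝕜 := ℝ)).const_add
      (c * gammaStar N s R x)
    rw [add_zero] at hlim
    exact ge_of_tendsto' hlim hx
  intro n
  set δ : ℝ := 1 / ((n : ℝ) + 1) with hδ
  have hδ0 : 0 < δ := by positivity
  obtain ⟨d, hd, hdM⟩ := exists_lt_mul_gammaStar (N := N) (s := s) hR M hδ0
  set v : Space N → ℝ := fun x => max (u x - c * gammaStar N s R x - δ) 0 with hv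
  have hvm : AEStronglyMeasurable v :=
    ((((hum.sub hwm).aemeasurable.sub_const δ).max aemeasurable_const)).aestronglyMeasurable
  have hv0 : ∀ x, 0 ≤ v x := fun x => le_max_right _ _
  set S : Set (Space N) := toMeasurable volume {x | ENNReal.ofReal δ ≤ ‖u x‖ₑ} with hS
  have hSm : MeasurableSet S := measurableSet_toMeasurable _ _
  have hSfin : volume S ≠ ⊤ := by
    rw [hS, measure_toMeasurable]
    exact (hu.mem.memLp.meas_ge_lt_top_enorm (by simpa using (by linarith : 0 < critExp N s))
      ENNReal.ofReal_ne_top (ε := δ.toNNReal) (by simpa using hδ0)).ne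
  have hSlt : ∀ x, x ∉ S → u x < δ := by
    intro x hx
    by_contra! hδu
    refine hx (subset_toMeasurable _ _ ?_)
    rw [Set.mem_ofPred_eq, Real.enorm_eq_ofReal (hδ0.le.trans hδu)]
    exact ENNReal.ofReal_le_ofReal hδu
  have hvS : ∀ x, x ∉ S → v x = 0 := fun x hx =>
    max_eq_right (by linarith [hSlt x hx, hΓ0 x])
  have hvE : FiniteEnergy K v := by
    refine FiniteEnergy.of_sq_le hK hvm
      (integrable_increments_bound hK hu.mem.finite_form hSm hSfin (2 * (c ^ 2 * C)) 2)
      (Eventually.of_forall fun z => ?_)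
    by_cases hz : z.1 ∈ S ∨ z.2 ∈ S
    · have h1 : (v z.1 - v z.2) ^ 2 ≤
          ((u z.1 - u z.2) - (c * gammaStar N s R z.1 - c * gammaStar N s R z.2)) ^ 2 := by
        refine sq_le_sq.2 ((abs_max_sub_max_le_abs _ _ _).trans_eq ?_)
        congr 1
        ring
      have h2 := (hw z.1 z.2).trans
        (mul_le_mul_of_nonneg_left (min_le_localWeight hz) (by positivity))
      nlinarith [sq_nonneg ((u z.1 - u z.2) +
        (c * gammaStar N s R z.1 - c * gammaStar N s R z.2))]
    · push Not at hz
      rw [hvS _ hz.1, hvS _ hz.2]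
      have := localWeight_nonneg S z
      simp only [sub_self, ne_eq, OfNat.ofNat_ne_zero, not_false_eq_true, zero_pow]
      positivity
  have hvu : ∀ᵐ x, v x ≤ u x := by
    filter_upwards [hu0] with x hx
    exact max_le (by linarith [hΓ0 x]) hx
  have hvmem : MemE s K V v := by
    refine hu.mem.of_abs_le hV hvm hvE ?_
    filter_upwards [hu0, hvu] with x hx hx'
    rwa [abs_of_nonneg (hv0 x), abs_of_nonneg hx]
  have hvz : ∀ᵐ x, ‖x‖ < R + d → v x = 0 := by
    filter_upwards [huM] with x hx hxd
    exact max_eq_right (by linarith [hdM x hxd])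
  -- the equation outside the ball
  have hfu : form K u v ≤ 0 := by
    have hint : Integrable fun x => V x * (u x * v x) := by
      refine hV.integrable_of_sq_le hu.mem.finite_potential (hum.mul hvm) ?_
      filter_upwards [hu0, hvu] with x hx hx'
      rw [abs_of_nonneg (mul_nonneg hx (hv0 x)), sq]
      exact mul_le_mul_of_nonneg_left hx' hx
    have h1 : ∫ x, gAux f V p q θ R lam k x (u x) * v x ≤ ∫ x, V x * (u x * v x) := by
      refine integral_mono_of_nonneg ?_ hint ?_
      · filter_upwards [hV.nonneg] with x hVx
        exact mul_nonneg (gAux_nonneg hf hpq hl hVx _) (hv0 x)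
      · filter_upwards [hV.nonneg, hu0, hvz] with x hVx hx hxz
        rcases le_or_gt ‖x‖ R with hxR | hxR
        · rw [hxz (by linarith)]
          simp
        · rw [← mul_assoc]
          refine mul_le_mul_of_nonneg_right ((gAux_le_potential hf hxR hx).trans ?_) (hv0 x)
          refine mul_le_of_le_one_left (mul_nonneg hVx hx) ?_
          rw [div_le_one (by linarith)]
          linarith
    have h2 := hu.weak v hvmem
    simp only [← mul_assoc] at h1
    rw [innerE] at h2
    linarith
  -- the supersolution property, applied to a representative with pointwise bounds
  have hfΓ : 0 ≤ form K (fun x => c * gammaStar N s R x) v := by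
    set v' : Space N → ℝ := Set.indicator {x | R + d ≤ ‖x‖} fun x =>
      max (min (u x) M - c * gammaStar N s R x - δ) 0 with hv'
    have hset : MeasurableSet {x : Space N | R + d ≤ ‖x‖} :=
      measurableSet_le measurable_const measurable_norm
    have hvv' : v =ᵐ[volume] v' := by
      filter_upwards [huM, hvz] with x hx hxz
      by_cases hxd : R + d ≤ ‖x‖
      · rw [hv', Set.indicator_of_mem (show x ∈ {x : Space N | R + d ≤ ‖x‖} from hxd),
          min_eq_left hx]
      · rw [hv', Set.indicator_of_notMem (show x ∉ {x : Space N | R + d ≤ ‖x‖} from hxd)]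
        exact hxz (not_le.1 hxd)
    rw [form_const_mul_left, form_congr (ae_eq_refl _) hvv']
    refine mul_nonneg hc0 (hK.form_gammaStar_nonneg hN hR (hvm.congr hvv') (hvE.congr hvv')
      (fun x => Set.indicator_nonneg (fun _ _ => le_max_right _ _) x) (B := M) (fun x => ?_) hSm hSfin
      (fun x hx => ?_) hd fun x hx => ?_)
    · refine Set.indicator_apply_le' (fun _ => max_le ?_ hM) fun _ => hM
      linarith [min_le_right (u x) M, hΓ0 x]
    · refine Set.indicator_apply_eq_zero.2 fun _ => max_eq_right ?_
      linarith [min_le_left (u x) M, hSlt x hx, hΓ0 x]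
    · exact Set.indicator_of_notMem (show x ∉ {x : Space N | R + d ≤ ‖x‖} from not_le.2 hx) _
  have hiu := FiniteEnergy.integrable_form hK hum hvm hu.mem.finite_form hvE
  have hiΓ : Integrable fun z : Space N × Space N =>
      (c * gammaStar N s R z.1 - c * gammaStar N s R z.2) * (v z.1 - v z.2) * K (z.1 - z.2) :=
    integrable_form_of_integrable_sq hK hwm hvm
      (H₁ := fun z => c ^ 2 * C * localWeight S z) (H₂ := fun z => (v z.1 - v z.2) ^ 2)
      (((integrable_localWeight hK hSm hSfin).const_mul (c ^ 2 * C)).congr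
        (Eventually.of_forall fun z => (mul_assoc _ _ _).symm)) hvE
      (Eventually.of_forall fun z => abs_mul_le_localWeight hw (by positivity) (hvS _) (hvS _))
  have hsub : form K (fun x => u x - c * gammaStar N s R x) v =
      form K u v - form K (fun x => c * gammaStar N s R x) v := by
    rw [form, form, form, ← integral_sub hiu hiΓ]
    congr 1
    funext z
    ring
  have hle : form K v v ≤ form K (fun x => u x - c * gammaStar N s R x) v := by
    refine form_self_le_form hK hvE ((hiu.sub hiΓ).congr (Eventually.of_forall fun z => ?_))
      (Eventually.of_forall fun z => sq_sub_truncation_le _ _ _)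
    simp only [Pi.sub_apply]
    ring
  have hzero := ae_eq_zero_of_form_nonpos hs0 hN hK (hvmem.integrable_rpow hs0 hN) hvE
    (by linarith)
  filter_upwards [hzero] with x hx
  have h1 : max (u x - c * gammaStar N s R x - δ) 0 = 0 := hx
  have h2 := le_max_left (u x - c * gammaStar N s R x - δ) 0
  linarith

end Comparison

end NonlocalSchrodinger

theorem proposition5p5 (N : ℕ) (s p q θ R Λ : ℝ) (hs0 : 0 < s) (hs1 : s < 1)
    (hN : 2 * s < (N : ℝ)) (hq : critExp N s ≤ q)
    (f : ℝ → ℝ) (V K : Space N → ℝ)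
    (hf : NonlinearityAssumptions N s p θ f)
    (hV : PotentialAssumptions N s R Λ V)
    (hK : KernelAssumptions N s R K) :
    ∃ Cstar : ℝ, 0 < Cstar ∧
      ∀ (lam : ℝ), 0 < lam → ∀ (k : ℕ) (u : Space N → ℝ),
        IsAuxSolution s f K V p q θ R lam k u →
        energy f K V p q θ R lam k u = minimaxLevel s K V (energy f K V p q θ R lam k) →
        eLpNorm u ⊤ volume ≤ ENNReal.ofReal
            (Cstar * (1 + lam * (k : ℝ) ^ (q - p)) ^ (1 / (critExp N s - p))) ∧
        ∀ᵐ x : Space N, R < ‖x‖ →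
          u x ≤ Cstar * R ^ ((N : ℝ) - 2 * s)
            * (1 + lam * (k : ℝ) ^ (q - p)) ^ (1 / (critExp N s - p))
            * ‖x‖ ^ (-((N : ℝ) - 2 * s)) := by
  have hpq : p < q := hf.p_lt.trans_le hq
  obtain ⟨c₀, hc₀, hlevel⟩ := exists_minimaxLevel_le hK hV hf hpq
  obtain ⟨C, hC, hbound⟩ := exists_forall_ae_le hs0 hN hK hV hf hpq hc₀
  refine ⟨C, hC, fun lam hl k u hu hJ => ?_⟩
  have huM := hbound lam hl k u hu (hJ.trans_le (hlevel lam hl k))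
  have hu0 := hu.ae_nonneg hs0 hN hK hV hf hpq
  refine ⟨?_, ?_⟩
  · rw [eLpNorm_exponent_top]
    refine eLpNormEssSup_le_of_ae_bound ?_
    filter_upwards [hu0, huM] with x hx hx'
    rwa [Real.norm_of_nonneg hx]
  · filter_upwards [hu.ae_le_gammaStar hs0 hN hK hV hf hpq hl (by positivity) huM] with x hx hxR
    rw [gammaStar, max_eq_left hxR.le] at hx
    exact hx.trans_eq (by ring)
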